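/- Let $r\in\mathbb{N}$, $k\in\mathbb{Z}$ with $0\le k\le r-1$, and $t\in(-1,1)$. Let $L_2=L_2([-1,1])$ be the real Hilbert space with norm $\|f\|_2=\left(\int_{-1}^1|f(x)|^2\,dx\right)^{1/2}$; let $L_2^m([a,b])$ be the space of functions $f:[a,b]\to\mathbb{R}$ having absolutely continuous derivative $f^{(m-1)}$ and such that $f^{(m)}\in L_2([a,b])$; and let $W^r_2=\{f\in L^r_2([-1,1]) : \|f^{(r)}\|_2\le 1\}$. Put $D^k_tf=f^{(k)}(t)$. For a functional $S:L_2\to\mathbb{R}$ set $$U(D^k_t;S;W^r_2)=\sup_{f\in W^r_2}\left|f^{(k)}(t)-Sf\right|,$$ and for $N\ge 0$ let $$E_N(D^k_t;W^r_2)=\inf\left\{U(D^k_t;S;W^r_2) : S:L_2\to\mathbb{R}\ \text{linear and bounded},\ \|S\|\le N\right\}.$$ Let $M_t$ be the sharp (smallest) constant $M\ge 0$ in the inequality $|Q^{(k)}(t)|\le M\|Q\|_2$ for all real polynomials $Q$ of degree at most $r-1$. For $\lambda\ge 0$ let $u_{\lambda,t}$ denote a solution, of class $L_2^{2r}$ on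 each of $(-1,t)$ and $(t,1)$, of the problem $$\begin{cases}(-1)^ru^{(2r)}(x)+\lambda u(x)=0, & x\in(-1,t)\cup(t,1),\\ u^{(s)}(-1)=u^{(s)}(1)=0, & s=0,1,\dots,r-1,\\ u^{(s)}(t+0)-u^{(s)}(t-0)=(-1)^{k-1}\delta_{r-k-1,s}, & s=0,1,\dots,2r-1,\end{cases}$$ where $\delta_{i,j}$ is the Kronecker symbol, and let $u^{(r)}_{\lambda,t}$ be its $r$-th derivative on $(-1,t)\cup(t,1)$. Theorem. (i) If $0\le N<M_t$, then $E_N(D^k_t;W^r_2)=+\infty$. (ii) If $N\ge M_t$, then there exist $\lambda_{N,t}\ge 0$ and a solution $u_{\lambda_{N,t},t}$ with $\|u^{(r)}_{\lambda_{N,t},t}\|_2=N$. For every such $\lambda_{N,t}$ and $u_{\lambda_{N,t},t}$, the functional $$S_{N,t}f=\int_{-1}^1u^{(r)}_{\lambda_{N,t},t}(x)f(x)\,dx,\qquad f\in L_2,$$ is linear and bounded with $\|S_{N,t}\|\le N$, and $$E_N(D^k_t;W^r_2)=U(D^k_t;S_{N,t};W^r_2)=\|u_{\lambda_{N,t},t}\|_2.$$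 -/

import Mathlib

open MeasureTheory Set Filter Topology
open scoped ENNReal

namespace Stechkin

noncomputable section

/-- Lebesgue measure on `[-1, 1]`. -/
abbrev μI : Measure ℝ := volume.restrict (Icc (-1 : ℝ) 1)

/-- The real Hilbert space `L_2 = L_2([-1, 1])`. -/
abbrev L2 : Type := Lp ℝ 2 μI

/-- `L_2^m` on `[a, b]`, for `m ≥ 1`: functions whose derivative of order `m - 1` exists and is
absolutely continuous on `[a, b]` and whose derivative of order `m` (which then exists almost
everywhere) lies in `L_2`. Only the values of the function on `[a, b]` matter. -/
def SobolevL2 (m : ℕ) (a b : ℝ) : Set (ℝ → ℝ) :=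
  {f | ContDiffOn ℝ ((m - 1 : ℕ) : WithTop ℕ∞) f (Icc a b) ∧
    AbsolutelyContinuousOnInterval (iteratedDerivWithin (m - 1) f (Icc a b)) a b ∧
    MemLp (iteratedDerivWithin m f (Icc a b)) 2 (volume.restrict (Icc a b))}

/-- The class `W^r_2`: functions in `L_2^r([-1, 1])` with `‖f^{(r)}‖_2 ≤ 1`. -/
def classW (r : ℕ) : Set (ℝ → ℝ) :=
  {f | f ∈ SobolevL2 r (-1) 1 ∧ eLpNorm (iteratedDerivWithin r f (Icc (-1) 1)) 2 μI ≤ 1}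

theorem SobolevL2.memLp {m : ℕ} {f : ℝ → ℝ} (hf : f ∈ SobolevL2 m (-1) 1) : MemLp f 2 μI := by
  have hc : ContinuousOn f (Icc (-1 : ℝ) 1) := hf.1.continuousOn
  obtain ⟨C, hC⟩ := isCompact_Icc.exists_bound_of_continuousOn hc
  refine MemLp.of_bound (hc.aestronglyMeasurable measurableSet_Icc) C ?_
  exact (ae_restrict_iff' measurableSet_Icc).2 (Eventually.of_forall hC)

/-- The element of `L_2` represented by a function of the class `W^r_2`. -/
def toL2 {r : ℕ} (f : classW r) : L2 := MemLp.toLp (f : ℝ → ℝ) (SobolevL2.memLp f.2.1)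

/-- The functional `D^k_t : f ↦ f^{(k)}(t)` for functions on `[-1, 1]`. -/
def pointDeriv (k : ℕ) (t : ℝ) (f : ℝ → ℝ) : ℝ := iteratedDerivWithin k f (Icc (-1) 1) t

/-- The deviation `U(D^k_t; S; W^r_2)`, the supremum of `|f^{(k)}(t) - S f|` over `f ∈ W^r_2`,
as an extended nonnegative number. -/
def deviation (r k : ℕ) (t : ℝ) (S : L2 → ℝ) : ℝ≥0∞ :=
  ⨆ f : classW r, ENNReal.ofReal |pointDeriv k t f - S (toL2 f)|

/-- The error `E_N(D^k_t; W^r_2)` of best approximation of `D^k_t` on `W^r_2` by linear bounded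
functionals on `L_2` of norm at most `N`. -/
def bestError (r k : ℕ) (t N : ℝ) : ℝ≥0∞ :=
  ⨅ (S : L2 →L[ℝ] ℝ) (_ : ‖S‖ ≤ N), deviation r k t S

/-- The sharp constant `M_t` in `|Q^{(k)}(t)| ≤ M ‖Q‖_2`, for polynomials `Q` of degree at
most `r - 1`. -/
def markovConst (r k : ℕ) (t : ℝ) : ℝ :=
  sInf {M : ℝ | 0 ≤ M ∧ ∀ Q ∈ Polynomial.degreeLT ℝ r,
    |(Polynomial.derivative^[k] Q).eval t| ≤ M * (eLpNorm (fun x => Q.eval x) 2 μI).toReal}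

/-- `u` is a solution `u_{lam,t}` of the boundary value problem
`(-1)^r u^{(2r)} + lam u = 0` on `(-1, t) ∪ (t, 1)`,
`u^{(s)}(-1) = u^{(s)}(1) = 0` for `0 ≤ s ≤ r - 1`,
`u^{(s)}(t+0) - u^{(s)}(t-0) = (-1)^{k-1} δ_{r-k-1,s}` for `0 ≤ s ≤ 2r - 1`,
of class `L_2^{2r}` on each of `(-1, t)` and `(t, 1)`. Boundary values are one-sided limits; the
values of `u` outside `(-1, t) ∪ (t, 1)` are irrelevant. -/
structure IsSolution (r k : ℕ) (t lam : ℝ) (u : ℝ → ℝ) : Prop where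
  left : ∃ v ∈ SobolevL2 (2 * r) (-1) t, EqOn u v (Ioo (-1) t)
  right : ∃ v ∈ SobolevL2 (2 * r) t 1, EqOn u v (Ioo t 1)
  ode : ∀ x ∈ Ioo (-1) t ∪ Ioo t 1, (-1) ^ r * iteratedDeriv (2 * r) u x + lam * u x = 0
  bdry_left : ∀ s < r, Tendsto (iteratedDeriv s u) (𝓝[>] (-1)) (𝓝 0)
  bdry_right : ∀ s < r, Tendsto (iteratedDeriv s u) (𝓝[<] 1) (𝓝 0)
  jump : ∀ s < 2 * r, ∃ p q : ℝ,
    Tendsto (iteratedDeriv s u) (𝓝[>] t) (𝓝 p) ∧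
    Tendsto (iteratedDeriv s u) (𝓝[<] t) (𝓝 q) ∧
    p - q = if s + k + 1 = r then (-1) ^ (k + 1) else 0

end

end Stechkin

/-! Let `u` solve the boundary value problem and put `V = u^(r)`. Integrating by parts on both sides
of `t`, the conditions at `±1` remove the end point terms and the single jump leaves `F^(k)(t)`:
F^(k)(t) = ∫ V F - (-1)^r ∫ u F^(r). By Cauchy-Schwarz the functional `⟨V, ·⟩` therefore has
deviation exactly `‖u‖` (`deviation_innerSL`).

Optimality comes from taking `V` itself as test function. The derivatives of `u` of orders `r, ...,
2r - 1` do not jump, so `V` lies in `L_2^r`, and the equation gives `V^(r) = -(-1)^r lam u`. The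
identity yields `V^(k)(t) = N^2 + lam ‖u‖^2`, while `S V ≤ N^2` whenever `‖S‖ ≤ N`. Normalizing `V`
by `‖V^(r)‖ = lam ‖u‖` gives deviation at least `‖u‖`; the case `lam = 0` is degenerate
(`le_deviation_of_norm_le`).

For existence, let `q` be the polynomial of degree below `r` representing `p ↦ p^(k)(t)`, and try `V
= q + h` with `h` orthogonal to these polynomials. The residual `F ↦ F^(k)(t) - ⟨V, F⟩` kills the
polynomials, so it equals `⟨w, F^(r)⟩` with `w` affine in `h`. The differential equation becomes `h
= lam C w`, where `C` is `r`-fold integration followed by projection off the polynomials: a Tikhonov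
regularization of `C w = 0`. That equation has no solution, since it would force `w = 0`, whereas
`w` is up to sign a function with a nonzero jump. Hence `‖h‖` takes every value in `[0, ∞)`
(`exists_tikhonov_norm_eq`), and `‖q‖ ≤ M_t` lets `‖V‖` reach any `N ≥ M_t`. Regularity is recovered
in `exists_isSplitChain_of_weak`.

For `N < M_t`, some polynomial has nonzero error under every admissible `S`, and all its multiples
lie in the class. -/

namespace Stechkin

/-! ### Indefinite Lebesgue integrals -/

/-- `f` is on `[a, b]` an indefinite Lebesgue integral of `f'`. -/
def IsPrim (a b : ℝ) (f f' : ℝ → ℝ) : Prop :=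
  IntervalIntegrable f' volume a b ∧ ∀ x ∈ Icc a b, f x = f a + ∫ y in a..x, f' y

namespace IsPrim

variable {a b : ℝ} {f f' g g' : ℝ → ℝ}

theorem intervalIntegrable_of_mem (hf : IsPrim a b f f') {x y : ℝ} (hx : x ∈ Icc a b)
    (hy : y ∈ Icc a b) : IntervalIntegrable f' volume x y := by
  refine hf.1.mono_set ?_
  have hab : a ≤ b := hx.1.trans hx.2
  rw [uIcc_of_le hab]
  exact uIcc_subset_Icc hx hy

theorem sub_eq (hf : IsPrim a b f f') {x y : ℝ} (hx : x ∈ Icc a b) (hy : y ∈ Icc a b) :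
    f y - f x = ∫ z in x..y, f' z := by
  have ha : a ∈ Icc a b := ⟨le_rfl, hx.1.trans hx.2⟩
  rw [hf.2 x hx, hf.2 y hy, ← intervalIntegral.integral_add_adjacent_intervals
    (hf.intervalIntegrable_of_mem ha hx) (hf.intervalIntegrable_of_mem hx hy)]
  ring

theorem of_sub_eq (hi : IntervalIntegrable f' volume a b)
    (h : ∀ x ∈ Icc a b, f x - f a = ∫ y in a..x, f' y) : IsPrim a b f f' :=
  ⟨hi, fun x hx => by rw [← h x hx]; ring⟩

theorem congr (hf : IsPrim a b f f') (h : EqOn g f (Icc a b))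
    (h' : g' =ᵐ[volume.restrict (Ioo a b)] f') (hab : a ≤ b) : IsPrim a b g g' := by
  rw [Measure.restrict_congr_set Ioo_ae_eq_Ioc] at h'
  refine ⟨hf.1.congr_ae (by rw [uIoc_of_le hab]; exact h'.symm), fun x hx => ?_⟩
  rw [h hx, h ⟨le_rfl, hab⟩, hf.2 x hx]
  congr 1
  refine intervalIntegral.integral_congr_ae_restrict ?_
  rw [uIoc_of_le hx.1]
  have h2 : g' =ᵐ[volume.restrict (Ioc a x)] f' :=
    ae_restrict_of_ae_restrict_of_subset (Ioc_subset_Ioc_right hx.2) h'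
  exact h2.symm

theorem absolutelyContinuous (hf : IsPrim a b f f') (hab : a ≤ b) :
    AbsolutelyContinuousOnInterval f a b := by
  have h := hf.1.absolutelyContinuousOnInterval_intervalIntegral (c := a) (by simp)
  have h2 : AbsolutelyContinuousOnInterval (fun x => f a + ∫ y in a..x, f' y) a b := by
    have hc : AbsolutelyContinuousOnInterval (fun _ : ℝ => f a) a b :=
      (LipschitzWith.const (f a)).lipschitzOnWith.absolutelyContinuousOnInterval
    exact hc.add h
  rw [absolutelyContinuousOnInterval_iff] at h2 ⊢
  intro ε hε
  obtain ⟨δ, hδ, H⟩ := h2 ε hε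
  refine ⟨δ, hδ, fun E hE hl => ?_⟩
  have := H E hE hl
  convert this using 2 with i hi
  have h3 := hE.1 i hi
  rw [uIcc_of_le hab] at h3
  rw [hf.2 _ h3.1, hf.2 _ h3.2]

theorem continuousOn (hf : IsPrim a b f f') (hab : a ≤ b) : ContinuousOn f (Icc a b) := by
  simpa [uIcc_of_le hab] using (hf.absolutelyContinuous hab).continuousOn

theorem ae_hasDerivAt (hf : IsPrim a b f f') :
    ∀ᵐ x, x ∈ Ioo a b → HasDerivAt f (f' x) x := by
  rcases lt_or_ge a b with hab | hab
  · filter_upwards [hf.1.ae_hasDerivAt_integral] with x hx hxI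
    have hx' : x ∈ uIcc a b := by rw [uIcc_of_le hab.le]; exact Ioo_subset_Icc_self hxI
    have h1 := (hx hx' a (by simp)).const_add (f a)
    refine h1.congr_of_eventuallyEq ?_
    filter_upwards [Icc_mem_nhds hxI.1 hxI.2] with y hy using hf.2 y hy
  · simp [Ioo_eq_empty (not_lt.2 hab)]

theorem ae_deriv_eq (hf : IsPrim a b f f') :
    deriv f =ᵐ[volume.restrict (Ioo a b)] f' := by
  rw [EventuallyEq, ae_restrict_iff' measurableSet_Ioo]
  filter_upwards [hf.ae_hasDerivAt] with x hx hxI using (hx hxI).deriv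

theorem of_absolutelyContinuous (hab : a ≤ b) (hf : AbsolutelyContinuousOnInterval f a b) :
    IsPrim a b f (deriv f) := by
  refine of_sub_eq hf.intervalIntegrable_deriv fun x hx => ?_
  refine ((hf.mono ?_).integral_deriv_eq_sub).symm
  rw [uIcc_of_le hx.1, uIcc_of_le hab]
  exact Icc_subset_Icc_right hx.2

theorem hasDerivWithinAt (hf : IsPrim a b f f') (hc : ContinuousOn f' (Icc a b))
    {x : ℝ} (hx : x ∈ Icc a b) : HasDerivWithinAt f (f' x) (Icc a b) x := by
  have hab : a ≤ b := hx.1.trans hx.2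
  have : Fact (x ∈ Icc a b) := ⟨hx⟩
  have h1 : HasDerivWithinAt (fun u => ∫ y in a..u, f' y) (f' x) (Icc a b) x :=
    intervalIntegral.integral_hasDerivWithinAt_right
      (hf.intervalIntegrable_of_mem ⟨le_rfl, hab⟩ hx)
      (hc.stronglyMeasurableAtFilter_nhdsWithin measurableSet_Icc x) (hc x hx)
  exact (h1.const_add (f a)).congr hf.2 (hf.2 x hx)

theorem of_hasDerivAt (hab : a ≤ b) (hf : ContinuousOn f (Icc a b))
    (hd : ∀ x ∈ Ioo a b, HasDerivAt f (f' x) x) (hc : ContinuousOn f' (Icc a b)) :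
    IsPrim a b f f' := by
  refine of_sub_eq (hc.intervalIntegrable_of_Icc hab) fun x hx => ?_
  refine (intervalIntegral.integral_eq_sub_of_hasDerivAt_of_le hx.1
    (hf.mono (Icc_subset_Icc_right hx.2)) (fun y hy => hd y ⟨hy.1, hy.2.trans_le hx.2⟩) ?_).symm
  exact (hc.mono (Icc_subset_Icc_right hx.2)).intervalIntegrable_of_Icc hx.1

theorem mono (hf : IsPrim a b f f') {c d : ℝ} (hc : c ∈ Icc a b) (hd : d ∈ Icc a b) :
    IsPrim c d f f' :=
  of_sub_eq (hf.intervalIntegrable_of_mem hc hd) fun _ hx =>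
    hf.sub_eq hc ⟨hc.1.trans hx.1, hx.2.trans hd.2⟩

theorem glue {c : ℝ} (hf : IsPrim a c f f') (hg : IsPrim c b f f') (hc : c ∈ Icc a b) :
    IsPrim a b f f' := by
  refine of_sub_eq (hf.1.trans hg.1) fun x hx => ?_
  rcases le_total x c with h | h
  · exact hf.sub_eq ⟨le_rfl, hc.1⟩ ⟨hx.1, h⟩
  · rw [← intervalIntegral.integral_add_adjacent_intervals hf.1
      (hg.intervalIntegrable_of_mem ⟨le_rfl, hc.2⟩ ⟨h, hx.2⟩),
      ← hf.sub_eq ⟨le_rfl, hc.1⟩ ⟨hc.1, le_rfl⟩, ← hg.sub_eq ⟨le_rfl, hc.2⟩ ⟨h, hx.2⟩]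
    ring

theorem add (hf : IsPrim a b f f') (hg : IsPrim a b g g') (hab : a ≤ b) :
    IsPrim a b (fun x => f x + g x) (fun x => f' x + g' x) := by
  refine of_sub_eq (hf.1.add hg.1) fun x hx => ?_
  have ha : a ∈ Icc a b := ⟨le_rfl, hab⟩
  rw [intervalIntegral.integral_add (hf.intervalIntegrable_of_mem ha hx)
    (hg.intervalIntegrable_of_mem ha hx), ← hf.sub_eq ha hx, ← hg.sub_eq ha hx]
  ring

theorem const_mul (hf : IsPrim a b f f') (c : ℝ) (hab : a ≤ b) :
    IsPrim a b (fun x => c * f x) (fun x => c * f' x) := by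
  refine of_sub_eq (hf.1.const_mul c) fun x hx => ?_
  rw [intervalIntegral.integral_const_mul, ← hf.sub_eq ⟨le_rfl, hab⟩ hx]
  ring

theorem integral_by_parts (hf : IsPrim a b f f') (hg : IsPrim a b g g') (hab : a ≤ b) :
    ∫ x in a..b, g' x * f x = g b * f b - g a * f a - ∫ x in a..b, g x * f' x := by
  have h := (hf.absolutelyContinuous hab).integral_mul_deriv_eq_deriv_mul
    (hg.absolutelyContinuous hab)
  have e1 : ∫ x in a..b, f x * deriv g x = ∫ x in a..b, g' x * f x := by
    refine intervalIntegral.integral_congr_ae_restrict ?_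
    rw [uIoc_of_le hab, ← Measure.restrict_congr_set Ioo_ae_eq_Ioc]
    filter_upwards [hg.ae_deriv_eq] with x hx
    rw [hx, mul_comm]
  have e2 : ∫ x in a..b, deriv f x * g x = ∫ x in a..b, g x * f' x := by
    refine intervalIntegral.integral_congr_ae_restrict ?_
    rw [uIoc_of_le hab, ← Measure.restrict_congr_set Ioo_ae_eq_Ioc]
    filter_upwards [hf.ae_deriv_eq] with x hx
    rw [hx, mul_comm]
  rw [e1, e2] at h
  rw [h]
  ring

end IsPrim

/-- The indefinite integral with base point `c`. -/
noncomputable def prim (c : ℝ) (g : ℝ → ℝ) (x : ℝ) : ℝ := ∫ y in c..x, g y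

theorem isPrim_prim {a b c : ℝ} {g : ℝ → ℝ} (hc : c ∈ Icc a b)
    (hg : IntervalIntegrable g volume a b) : IsPrim a b (prim c g) g := by
  have hab : a ≤ b := hc.1.trans hc.2
  have hi : ∀ x ∈ Icc a b, ∀ y ∈ Icc a b, IntervalIntegrable g volume x y := fun x hx y hy =>
    hg.mono_set (by rw [uIcc_of_le hab]; exact uIcc_subset_Icc hx hy)
  refine IsPrim.of_sub_eq hg fun x hx => ?_
  have ha : a ∈ Icc a b := ⟨le_rfl, hab⟩
  exact intervalIntegral.integral_interval_sub_left (hi c hc x hx) (hi c hc a ha)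

/-! ### Chains of successive primitives and Sobolev functions -/

/-- A sequence of functions on `[a, b]`, each of the first `m` being a primitive of the next. -/
def IsChain (m : ℕ) (a b : ℝ) (F : ℕ → ℝ → ℝ) : Prop :=
  ∀ j < m, IsPrim a b (F j) (F (j + 1))

namespace IsChain

variable {m : ℕ} {a b : ℝ} {F G : ℕ → ℝ → ℝ}

theorem continuousOn (hF : IsChain m a b F) (hab : a ≤ b) {j : ℕ} (hj : j < m) :
    ContinuousOn (F j) (Icc a b) := (hF j hj).continuousOn hab

theorem mono (hF : IsChain m a b F) {c d : ℝ} (hc : c ∈ Icc a b) (hd : d ∈ Icc a b) :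
    IsChain m c d F := fun j hj => (hF j hj).mono hc hd

theorem integral_by_parts (hF : IsChain m a b F) (hG : IsChain m a b G) (hab : a ≤ b) :
    ∫ x in a..b, G m x * F 0 x =
      ∑ j ∈ Finset.range m,
        (-1) ^ j * (G (m - 1 - j) b * F j b - G (m - 1 - j) a * F j a) +
      (-1) ^ m * ∫ x in a..b, G 0 x * F m x := by
  induction m generalizing F with
  | zero => simp
  | succ m ih =>
    -- One derivative moves from `G` to `F`: the chain `F` is shifted by one and the chain `G` loses
    -- its last member.
    rw [(hF 0 (Nat.succ_pos m)).integral_by_parts (hG m (Nat.lt_succ_self m)) hab,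
      ih (F := fun j => F (j + 1)) (fun j hj => hF (j + 1) (Nat.succ_lt_succ hj))
        (fun j hj => hG j (hj.trans (Nat.lt_succ_self m))), Finset.sum_range_succ', add_comm m 1]
    simp only [Nat.add_sub_cancel_left, pow_zero, one_mul, Nat.sub_zero]
    simp only [pow_add, pow_one, Nat.sub_add_eq, Nat.sub_right_comm m _ 1]
    simp only [mul_neg, mul_one, neg_mul, Finset.sum_neg_distrib, one_mul]
    ring

theorem of_prim {c : ℝ} {g : ℝ → ℝ} (hc : c ∈ Icc a b) (hg : IntervalIntegrable g volume a b)
    (m : ℕ) : IsChain m a b (fun j => (prim c)^[m - j] g) := by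
  have hi : ∀ i, IntervalIntegrable ((prim c)^[i] g) volume a b := by
    intro i
    induction i with
    | zero => exact hg
    | succ i ih =>
      rw [Function.iterate_succ_apply']
      exact ((isPrim_prim hc ih).continuousOn (hc.1.trans hc.2)).intervalIntegrable_of_Icc
        (hc.1.trans hc.2)
  intro j hj
  have : m - j = (m - (j + 1)) + 1 := by omega
  simp only [this, Function.iterate_succ_apply']
  exact isPrim_prim hc (hi _)

end IsChain

theorem iterate_prim_self (c : ℝ) (g : ℝ → ℝ) {i : ℕ} (hi : 0 < i) : (prim c)^[i] g c = 0 := by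
  obtain ⟨i, rfl⟩ := Nat.exists_eq_succ_of_ne_zero hi.ne'
  rw [Function.iterate_succ_apply']
  simp [prim]

theorem SobolevL2.isChain {m : ℕ} {a b : ℝ} {f : ℝ → ℝ} (hf : f ∈ SobolevL2 m a b) (hm : 1 ≤ m)
    (hab : a < b) : IsChain m a b (fun j => iteratedDerivWithin j f (Icc a b)) := by
  obtain ⟨m, rfl⟩ := Nat.exists_eq_add_of_le' hm
  obtain ⟨h1, h2, -⟩ := hf
  have hu := uniqueDiffOn_Icc hab
  simp only [Nat.add_sub_cancel] at h1 h2
  intro j hj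
  rcases (Nat.lt_succ_iff.1 hj).lt_or_eq with hj | rfl
  · refine IsPrim.of_hasDerivAt hab.le
      (h1.continuousOn_iteratedDerivWithin (by exact_mod_cast hj.le) hu) (fun x hx => ?_)
      (h1.continuousOn_iteratedDerivWithin (by exact_mod_cast hj) hu)
    have hd := (h1.differentiableOn_iteratedDerivWithin (by exact_mod_cast hj) hu x
      (Ioo_subset_Icc_self hx)).hasDerivWithinAt
    rw [← iteratedDerivWithin_succ] at hd
    exact hd.hasDerivAt (Icc_mem_nhds hx.1 hx.2)
  · refine (IsPrim.of_absolutelyContinuous hab.le h2).congr (fun x _ => rfl) ?_ hab.le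
    refine (ae_restrict_iff' measurableSet_Ioo).2 (Eventually.of_forall fun x hx => ?_)
    simp only [iteratedDerivWithin_succ, derivWithin_of_mem_nhds (Icc_mem_nhds hx.1 hx.2)]

/-- Continuity of `F n` makes the fundamental theorem of calculus hold at every point. It is
automatic for `n < m`; at the top order a chain only provides an almost everywhere derivative. -/
theorem IsChain.iteratedDerivWithin_eqOn {m : ℕ} {a b : ℝ} {F : ℕ → ℝ → ℝ} {f : ℝ → ℝ}
    (hF : IsChain m a b F) (hab : a < b) (hf : EqOn f (F 0) (Icc a b)) {n : ℕ} (hn : n ≤ m)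
    (hc : ContinuousOn (F n) (Icc a b)) :
    EqOn (iteratedDerivWithin n f (Icc a b)) (F n) (Icc a b) := by
  induction n with
  | zero => simpa using hf
  | succ n ih =>
    have ih := ih (by omega) (hF.continuousOn hab.le hn)
    intro x hx
    rw [iteratedDerivWithin_succ, derivWithin_congr ih (ih hx)]
    exact ((hF n hn).hasDerivWithinAt hc hx).derivWithin (uniqueDiffOn_Icc hab x hx)

theorem IsChain.iteratedDerivWithin_ae {m : ℕ} {a b : ℝ} {F : ℕ → ℝ → ℝ} {f : ℝ → ℝ}
    (hF : IsChain m a b F) (hab : a < b) (hf : EqOn f (F 0) (Icc a b)) (hm : 1 ≤ m) :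
    iteratedDerivWithin m f (Icc a b) =ᵐ[volume.restrict (Icc a b)] F m := by
  obtain ⟨m, rfl⟩ := Nat.exists_eq_add_of_le' hm
  have h := hF.iteratedDerivWithin_eqOn hab hf (Nat.le_succ m)
    (hF.continuousOn hab.le (Nat.lt_succ_self m))
  rw [← Measure.restrict_congr_set Ioo_ae_eq_Icc]
  refine EventuallyEq.trans ?_ (hF m (Nat.lt_succ_self m)).ae_deriv_eq
  refine (ae_restrict_iff' measurableSet_Ioo).2 (Eventually.of_forall fun x hx => ?_)
  have hn := Icc_mem_nhds hx.1 hx.2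
  rw [iteratedDerivWithin_succ, derivWithin_of_mem_nhds hn]
  exact (h.eventuallyEq_of_mem hn).deriv_eq

theorem IsChain.mem_sobolevL2 {m : ℕ} {a b : ℝ} {F : ℕ → ℝ → ℝ} {f : ℝ → ℝ}
    (hF : IsChain m a b F) (hab : a < b) (hf : EqOn f (F 0) (Icc a b)) (hm : 1 ≤ m)
    (hL : MemLp (F m) 2 (volume.restrict (Icc a b))) : f ∈ SobolevL2 m a b := by
  refine ⟨?_, ?_, hL.ae_eq (hF.iteratedDerivWithin_ae hab hf hm).symm⟩
  · have hu := uniqueDiffOn_Icc hab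
    have he : ∀ j < m, EqOn (iteratedDerivWithin j f (Icc a b)) (F j) (Icc a b) := fun j hj =>
      hF.iteratedDerivWithin_eqOn hab hf hj.le (hF.continuousOn hab.le hj)
    have := (contDiffOn_iff_continuousOn_differentiableOn_deriv (𝕜 := ℝ) (f := f)
      (n := ((m - 1 : ℕ) : ℕ∞)) hu).2 ⟨fun j hj => ?_, fun j hj => ?_⟩
    · exact_mod_cast this
    · have hj : j ≤ m - 1 := by exact_mod_cast hj
      exact (hF.continuousOn hab.le (by omega)).congr (he j (by omega))
    · have hj : j < m - 1 := by exact_mod_cast hj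
      refine DifferentiableOn.congr (fun x hx => ?_) (he j (by omega))
      exact ((hF j (by omega)).hasDerivWithinAt (hF.continuousOn hab.le (by omega))
        hx).differentiableWithinAt
  · refine IsPrim.absolutelyContinuous (f' := F m) ?_ hab.le
    have h := hF (m - 1) (by omega)
    rw [Nat.sub_add_cancel hm] at h
    exact h.congr (hF.iteratedDerivWithin_eqOn hab hf (by omega)
      (hF.continuousOn hab.le (by omega))) EventuallyEq.rfl hab.le

theorem isChain_polynomial (p : Polynomial ℝ) (m : ℕ) {a b : ℝ} (hab : a ≤ b) :
    IsChain m a b (fun j x => (Polynomial.derivative^[j] p).eval x) := by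
  intro j _
  refine IsPrim.of_hasDerivAt hab (Polynomial.continuousOn _) (fun x _ => ?_)
    (Polynomial.continuousOn _)
  simp only [Function.iterate_succ_apply']
  exact Polynomial.hasDerivAt _ _

/-! ### Gluing at `t` and integration by parts across a jump -/

/-- The function equal to `f` up to `t` and to `g` after `t`. -/
noncomputable def glue (t : ℝ) (f g : ℝ → ℝ) (x : ℝ) : ℝ := if x ≤ t then f x else g x

section glue

variable {t : ℝ} {f g f' g' : ℝ → ℝ}

theorem glue_of_le {x : ℝ} (h : x ≤ t) : glue t f g x = f x := if_pos h

theorem glue_of_lt {x : ℝ} (h : t < x) : glue t f g x = g x := if_neg h.not_ge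

theorem glue_ae_left : glue t f g =ᵐ[volume.restrict (Ioo (-1) t)] f :=
  (ae_restrict_iff' measurableSet_Ioo).2 (Eventually.of_forall fun _ hx => glue_of_le hx.2.le)

theorem glue_ae_right : glue t f g =ᵐ[volume.restrict (Ioo t 1)] g :=
  (ae_restrict_iff' measurableSet_Ioo).2 (Eventually.of_forall fun _ hx => glue_of_lt hx.1)

theorem isPrim_glue (ht : t ∈ Icc (-1 : ℝ) 1) (hf : IsPrim (-1) t f f') (hg : IsPrim t 1 g g')
    (h : f t = g t) : IsPrim (-1) 1 (glue t f g) (glue t f' g') := by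
  refine IsPrim.glue (c := t) (hf.congr (fun x hx => glue_of_le hx.2) glue_ae_left ht.1)
    (hg.congr (fun x hx => ?_) glue_ae_right ht.2) ht
  rcases hx.1.eq_or_lt with rfl | h'
  · rw [glue_of_le le_rfl, h]
  · exact glue_of_lt h'

/-- A property that holds almost everywhere on each of `(-1, t)` and `(t, 1)` holds almost everywhere
on `[-1, 1]`. -/
theorem ae_of_halves {p : ℝ → Prop} (h1 : ∀ᵐ x ∂volume.restrict (Ioo (-1) t), p x)
    (h2 : ∀ᵐ x ∂volume.restrict (Ioo t 1), p x) : ∀ᵐ x ∂μI, p x := by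
  rw [ae_restrict_iff' measurableSet_Ioo] at h1 h2
  rw [ae_restrict_iff' measurableSet_Icc]
  have h3 : ∀ᵐ x : ℝ, x ≠ -1 ∧ x ≠ t ∧ x ≠ 1 := by
    have : ∀ c : ℝ, ∀ᵐ x : ℝ, x ≠ c := fun c => by simp [ae_iff]
    filter_upwards [this (-1), this t, this 1] with x a b c using ⟨a, b, c⟩
  filter_upwards [h1, h2, h3] with x h1 h2 h3 hx
  rcases lt_or_gt_of_ne h3.2.1 with h | h
  · exact h1 ⟨lt_of_le_of_ne hx.1 (Ne.symm h3.1), h⟩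
  · exact h2 ⟨h, lt_of_le_of_ne hx.2 h3.2.2⟩

theorem ae_of_ae {p : ℝ → Prop} {s : Set ℝ} (h : ∀ᵐ x ∂μI, p x) (hs : s ⊆ Icc (-1) 1) :
    ∀ᵐ x ∂volume.restrict s, p x := ae_restrict_of_ae_restrict_of_subset hs h

theorem intervalIntegral_congr_Ioo {a b : ℝ} (hab : a ≤ b)
    (h : f =ᵐ[volume.restrict (Ioo a b)] g) : ∫ x in a..b, f x = ∫ x in a..b, g x := by
  refine intervalIntegral.integral_congr_ae_restrict ?_
  rwa [uIoc_of_le hab, ← Measure.restrict_congr_set Ioo_ae_eq_Ioc]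

theorem integral_split {h : ℝ → ℝ} (ht : t ∈ Icc (-1 : ℝ) 1)
    (hf : IntervalIntegrable f volume (-1) t) (hg : IntervalIntegrable g volume t 1)
    (h1 : h =ᵐ[volume.restrict (Ioo (-1) t)] f) (h2 : h =ᵐ[volume.restrict (Ioo t 1)] g) :
    ∫ x in (-1 : ℝ)..1, h x = (∫ x in (-1)..t, f x) + ∫ x in t..1, g x := by
  rw [← intervalIntegral_congr_Ioo ht.1 h1, ← intervalIntegral_congr_Ioo ht.2 h2]
  rw [Measure.restrict_congr_set Ioo_ae_eq_Ioc] at h1 h2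
  refine (intervalIntegral.integral_add_adjacent_intervals ?_ ?_).symm
  · exact hf.congr_ae (by rw [uIoc_of_le ht.1]; exact h1.symm)
  · exact hg.congr_ae (by rw [uIoc_of_le ht.2]; exact h2.symm)

end glue

/-- Integration by parts against a pair of chains on the two halves of `[-1, 1]` that vanish at
the end points. -/
theorem integral_by_parts_jump {r : ℕ} {t : ℝ} (ht : t ∈ Icc (-1 : ℝ) 1) {F A B : ℕ → ℝ → ℝ}
    (hr : 1 ≤ r) (hF : IsChain r (-1) 1 F) (hL : IsChain r (-1) t A) (hR : IsChain r t 1 B)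
    (hL0 : ∀ j < r, A j (-1) = 0) (hR0 : ∀ j < r, B j 1 = 0) :
    ∫ x in (-1 : ℝ)..1, glue t (A r) (B r) x * F 0 x =
      ∑ j ∈ Finset.range r, (-1) ^ j * (A (r - 1 - j) t - B (r - 1 - j) t) * F j t +
      (-1) ^ r * ∫ x in (-1 : ℝ)..1, glue t (A 0) (B 0) x * F r x := by
  have h1 : (-1 : ℝ) ∈ Icc (-1 : ℝ) 1 := by norm_num
  have h2 : (1 : ℝ) ∈ Icc (-1 : ℝ) 1 := by norm_num
  have hFL := hF.mono h1 ht
  have hFR := hF.mono ht h2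
  have hr' : r - 1 + 1 = r := Nat.sub_add_cancel hr
  have key : ∀ {a b : ℝ} {F G : ℕ → ℝ → ℝ}, a ≤ b → IsChain r a b F → IsChain r a b G →
      IntervalIntegrable (fun x => G r x * F 0 x) volume a b := by
    intro a b F G hab hF hG
    have hi := (hG (r - 1) (by omega)).1
    rw [hr'] at hi
    refine hi.mul_continuousOn ?_
    rw [uIcc_of_le hab]
    exact hF.continuousOn hab (by omega)
  rw [integral_split (h := fun x => glue t (A r) (B r) x * F 0 x) ht (key ht.1 hFL hL) (key ht.2 hFR hR)
      (glue_ae_left.mul EventuallyEq.rfl)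
      (glue_ae_right.mul EventuallyEq.rfl),
    integral_split (f := fun x => A 0 x * F r x) (g := fun x => B 0 x * F r x)
      (h := fun x => glue t (A 0) (B 0) x * F r x) ht
      ((key ht.1 hL hFL).congr fun x _ => mul_comm _ _)
      ((key ht.2 hR hFR).congr fun x _ => mul_comm _ _)
      (glue_ae_left.mul EventuallyEq.rfl)
      (glue_ae_right.mul EventuallyEq.rfl),
    hFL.integral_by_parts hL ht.1, hFR.integral_by_parts hR ht.2]
  have e : ∑ j ∈ Finset.range r, (-1) ^ j * (A (r - 1 - j) t - B (r - 1 - j) t) * F j t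
      = (∑ j ∈ Finset.range r,
        (-1) ^ j * (A (r - 1 - j) t * F j t - A (r - 1 - j) (-1) * F j (-1))) +
      ∑ j ∈ Finset.range r,
        (-1) ^ j * (B (r - 1 - j) 1 * F j 1 - B (r - 1 - j) t * F j t) := by
    rw [← Finset.sum_add_distrib]
    refine Finset.sum_congr rfl fun j hj => ?_
    rw [hL0 (r - 1 - j) (by omega), hR0 (r - 1 - j) (by omega)]
    ring
  rw [e]
  ring

theorem memLp_of_continuousOn {a b : ℝ} {f : ℝ → ℝ} (hf : ContinuousOn f (Icc a b)) :
    MemLp f 2 (volume.restrict (Icc a b)) := by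
  obtain ⟨C, hC⟩ := isCompact_Icc.exists_bound_of_continuousOn hf
  refine MemLp.of_bound (hf.aestronglyMeasurable measurableSet_Icc) C ?_
  exact (ae_restrict_iff' measurableSet_Icc).2 (Eventually.of_forall hC)

theorem memLp_glue {t : ℝ} {f g : ℝ → ℝ} (hf : ContinuousOn f (Icc (-1) t))
    (hg : ContinuousOn g (Icc t 1)) : MemLp (glue t f g) 2 μI := by
  have e : glue t f g = (Iic t).piecewise f g := by
    ext x; simp [glue, piecewise]
  rw [e]
  refine MemLp.piecewise measurableSet_Iic ?_ ?_
  · rw [Measure.restrict_restrict measurableSet_Iic]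
    refine (memLp_of_continuousOn hf).mono_measure
      (Measure.restrict_mono (fun x hx => ?_) le_rfl)
    exact ⟨hx.2.1, hx.1⟩
  · rw [Measure.restrict_restrict measurableSet_Iic.compl]
    refine (memLp_of_continuousOn hg).mono_measure
      (Measure.restrict_mono (fun x hx => ?_) le_rfl)
    have := hx.1
    simp only [mem_compl_iff, mem_Iic, not_le] at this
    exact ⟨this.le, hx.2.2⟩

/-! ### The boundary value problem in terms of chains -/

theorem iteratedDeriv_eqOn_Ioo {a b : ℝ} {u v : ℝ → ℝ} (h : EqOn u v (Ioo a b)) (n : ℕ) :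
    EqOn (iteratedDeriv n u) (iteratedDerivWithin n v (Icc a b)) (Ioo a b) := by
  intro x hx
  have h1 : u =ᶠ[𝓝 x] v := h.eventuallyEq_of_mem (Ioo_mem_nhds hx.1 hx.2)
  rw [h1.iteratedDeriv_eq n, ← iteratedDerivWithin_univ, iteratedDerivWithin, iteratedDerivWithin,
    iteratedFDerivWithin_congr_set (s := Icc a b) (t := univ)]
  exact (eventuallyEq_univ.2 (Icc_mem_nhds hx.1 hx.2))

theorem tendsto_nhdsGT_of_eqOn {a b : ℝ} (hab : a < b) {f g : ℝ → ℝ}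
    (hf : ContinuousOn f (Icc a b)) (h : EqOn g f (Ioo a b)) :
    Tendsto g (𝓝[>] a) (𝓝 (f a)) := by
  have h1 : Tendsto f (𝓝[Ioo a b] a) (𝓝 (f a)) :=
    (hf a ⟨le_rfl, hab.le⟩).mono_left (nhdsWithin_mono _ Ioo_subset_Icc_self)
  rw [nhdsWithin_Ioo_eq_nhdsGT hab] at h1
  exact h1.congr' (h.symm.eventuallyEq_of_mem (Ioo_mem_nhdsGT hab))

theorem tendsto_nhdsLT_of_eqOn {a b : ℝ} (hab : a < b) {f g : ℝ → ℝ}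
    (hf : ContinuousOn f (Icc a b)) (h : EqOn g f (Ioo a b)) :
    Tendsto g (𝓝[<] b) (𝓝 (f b)) := by
  have h1 : Tendsto f (𝓝[Ioo a b] b) (𝓝 (f b)) :=
    (hf b ⟨hab.le, le_rfl⟩).mono_left (nhdsWithin_mono _ Ioo_subset_Icc_self)
  rw [nhdsWithin_Ioo_eq_nhdsLT hab] at h1
  exact h1.congr' (h.symm.eventuallyEq_of_mem (Ioo_mem_nhdsLT hab))

/-- A pair of chains on the halves of `[-1, 1]` with the boundary values and the jumps at `t` of
the boundary value problem, up to order `m`. -/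
structure IsSplitChain (r k m : ℕ) (t : ℝ) (A B : ℕ → ℝ → ℝ) : Prop where
  left : IsChain m (-1) t A
  right : IsChain m t 1 B
  zero_left : ∀ j < r, A j (-1) = 0
  zero_right : ∀ j < r, B j 1 = 0
  jump : ∀ j < m, B j t - A j t = if j + k + 1 = r then (-1) ^ (k + 1) else 0

theorem IsSolution.exists_isSplitChain {r k : ℕ} {t lam : ℝ} {u : ℝ → ℝ} (hr : 1 ≤ r)
    (ht : t ∈ Ioo (-1 : ℝ) 1) (h : IsSolution r k t lam u) :
    ∃ A B : ℕ → ℝ → ℝ, IsSplitChain r k (2 * r) t A B ∧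
      (∀ j, EqOn (iteratedDeriv j u) (A j) (Ioo (-1) t)) ∧
      ∀ j, EqOn (iteratedDeriv j u) (B j) (Ioo t 1) := by
  obtain ⟨v, hv, huv⟩ := h.left
  obtain ⟨w, hw, huw⟩ := h.right
  have hA := SobolevL2.isChain hv (by omega) ht.1
  have hB := SobolevL2.isChain hw (by omega) ht.2
  have eA := fun j => iteratedDeriv_eqOn_Ioo huv j
  have eB := fun j => iteratedDeriv_eqOn_Ioo huw j
  refine ⟨_, _, ⟨hA, hB, fun j hj => ?_, fun j hj => ?_, fun j hj => ?_⟩, eA, eB⟩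
  · exact tendsto_nhds_unique
      (tendsto_nhdsGT_of_eqOn ht.1 (hA.continuousOn ht.1.le (by omega)) (eA j)) (h.bdry_left j hj)
  · exact tendsto_nhds_unique
      (tendsto_nhdsLT_of_eqOn ht.2 (hB.continuousOn ht.2.le (by omega)) (eB j)) (h.bdry_right j hj)
  · obtain ⟨p, q, hp, hq, hpq⟩ := h.jump j hj
    rw [← hpq]
    congr 1
    · exact tendsto_nhds_unique
        (tendsto_nhdsGT_of_eqOn ht.2 (hB.continuousOn ht.2.le hj) (eB j)) hp
    · exact tendsto_nhds_unique
        (tendsto_nhdsLT_of_eqOn ht.1 (hA.continuousOn ht.1.le hj) (eA j)) hq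

/-- The equation makes the member of order `2r` a multiple of the continuous member of order `0`. So
the chains are classical derivatives up to order `2r`, and the equation holds pointwise rather than
almost everywhere. -/
theorem IsSplitChain.isSolution {r k : ℕ} {t lam : ℝ} {A B : ℕ → ℝ → ℝ} (hr : 1 ≤ r)
    (ht : t ∈ Ioo (-1 : ℝ) 1) (h : IsSplitChain r k (2 * r) t A B)
    (hA : ∀ x, (-1) ^ r * A (2 * r) x + lam * A 0 x = 0)
    (hB : ∀ x, (-1) ^ r * B (2 * r) x + lam * B 0 x = 0) :
    IsSolution r k t lam (glue t (A 0) (B 0)) ∧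
      (∀ j ≤ 2 * r, EqOn (iteratedDeriv j (glue t (A 0) (B 0))) (A j) (Ioo (-1) t)) ∧
      ∀ j ≤ 2 * r, EqOn (iteratedDeriv j (glue t (A 0) (B 0))) (B j) (Ioo t 1) := by
  have solve : ∀ {F : ℕ → ℝ → ℝ}, (∀ x, (-1) ^ r * F (2 * r) x + lam * F 0 x = 0) →
      F (2 * r) = fun x => -(-1) ^ r * lam * F 0 x := by
    intro F hF
    ext x
    have h1 : ((-1 : ℝ) ^ r) * (-1) ^ r = 1 := by rw [← mul_pow]; norm_num
    linear_combination (-1) ^ r * hF x - F (2 * r) x * h1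
  have cont : ∀ {a b : ℝ} {F : ℕ → ℝ → ℝ}, a < b → IsChain (2 * r) a b F →
      (∀ x, (-1) ^ r * F (2 * r) x + lam * F 0 x = 0) → ∀ j ≤ 2 * r,
      ContinuousOn (F j) (Icc a b) := by
    intro a b F hab hF hF' j hj
    rcases hj.lt_or_eq with hj | rfl
    · exact hF.continuousOn hab.le hj
    · rw [solve hF']
      exact continuousOn_const.mul (hF.continuousOn hab.le (by omega))
  have uA : EqOn (glue t (A 0) (B 0)) (A 0) (Ioo (-1) t) := fun x hx => glue_of_le hx.2.le
  have uB : EqOn (glue t (A 0) (B 0)) (B 0) (Ioo t 1) := fun x hx => glue_of_lt hx.1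
  have cA := cont ht.1 h.left hA
  have cB := cont ht.2 h.right hB
  have eA : ∀ j ≤ 2 * r, EqOn (iteratedDeriv j (glue t (A 0) (B 0))) (A j) (Ioo (-1) t) :=
    fun j hj => (iteratedDeriv_eqOn_Ioo uA j).trans ((h.left.iteratedDerivWithin_eqOn ht.1
      (eqOn_refl _ _) hj (cA j hj)).mono Ioo_subset_Icc_self)
  have eB : ∀ j ≤ 2 * r, EqOn (iteratedDeriv j (glue t (A 0) (B 0))) (B j) (Ioo t 1) :=
    fun j hj => (iteratedDeriv_eqOn_Ioo uB j).trans ((h.right.iteratedDerivWithin_eqOn ht.2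
      (eqOn_refl _ _) hj (cB j hj)).mono Ioo_subset_Icc_self)
  refine ⟨⟨?_, ?_, ?_, ?_, ?_, ?_⟩, eA, eB⟩
  · exact ⟨A 0, h.left.mem_sobolevL2 ht.1 (eqOn_refl _ _) (by omega)
      (memLp_of_continuousOn (cA _ le_rfl)), uA⟩
  · exact ⟨B 0, h.right.mem_sobolevL2 ht.2 (eqOn_refl _ _) (by omega)
      (memLp_of_continuousOn (cB _ le_rfl)), uB⟩
  · rintro x (hx | hx)
    · rw [eA _ le_rfl hx, uA hx, hA]
    · rw [eB _ le_rfl hx, uB hx, hB]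
  · intro s hs
    rw [← h.zero_left s hs]
    exact tendsto_nhdsGT_of_eqOn ht.1 (cA s (by omega)) (eA s (by omega))
  · intro s hs
    rw [← h.zero_right s hs]
    exact tendsto_nhdsLT_of_eqOn ht.2 (cB s (by omega)) (eB s (by omega))
  · intro s hs
    exact ⟨B s t, A s t, tendsto_nhdsGT_of_eqOn ht.2 (cB s hs.le) (eB s hs.le),
      tendsto_nhdsLT_of_eqOn ht.1 (cA s hs.le) (eA s hs.le), h.jump s hs⟩

/-- The fundamental identity. Only the jump of order `r - 1 - k` survives in the sum; it is paired
with `F k t`, and its sign `(-1)^(k+1)` cancels the sign from the integrations by parts. -/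
theorem IsSplitChain.integral_eq {r k m : ℕ} {t : ℝ} {A B F : ℕ → ℝ → ℝ} (hk : k < r)
    (hm : r ≤ m) (ht : t ∈ Icc (-1 : ℝ) 1) (h : IsSplitChain r k m t A B)
    (hF : IsChain r (-1) 1 F) :
    ∫ x in (-1 : ℝ)..1, glue t (A r) (B r) x * F 0 x =
      F k t + (-1) ^ r * ∫ x in (-1 : ℝ)..1, glue t (A 0) (B 0) x * F r x := by
  rw [integral_by_parts_jump ht (by omega) hF (fun j hj => h.left j (by omega))
    (fun j hj => h.right j (by omega)) h.zero_left h.zero_right]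
  congr 1
  rw [Finset.sum_eq_single_of_mem k (Finset.mem_range.2 hk)]
  · have := h.jump (r - 1 - k) (by omega)
    rw [if_pos (by omega)] at this
    have h1 : ((-1 : ℝ) ^ k) * (-1) ^ k = 1 := by rw [← mul_pow]; norm_num
    rw [pow_succ] at this
    linear_combination (-(-1) ^ k * F k t) * this + F k t * h1
  · intro j hj hjk
    have hj := Finset.mem_range.1 hj
    have := h.jump (r - 1 - j) (by omega)
    rw [if_neg (by omega)] at this
    linear_combination (-(-1) ^ j * F j t) * this

/-! ### From the weak form back to boundary values and jumps -/

theorem eval_iterate_derivative_X_sub_C_pow (t : ℝ) (i j : ℕ) :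
    (Polynomial.derivative^[j] ((Polynomial.X - Polynomial.C t) ^ i)).eval t =
      if j = i then (i.factorial : ℝ) else 0 := by
  rw [Polynomial.iterate_derivative_X_sub_pow]
  rcases lt_trichotomy j i with h | rfl | h
  · have h2 : i - j ≠ 0 := by omega
    simp [h.ne, h2]
  · simp [Nat.descFactorial_self]
  · simp [h.ne', Nat.descFactorial_of_lt h]

/-- The weak form of the boundary value problem determines the split chain: `v` is the `r`-th
derivative of a function with the required boundary values and jumps, and `w` is, up to sign,
that function. -/
theorem exists_isSplitChain_of_weak {r k : ℕ} {t : ℝ} (hk : k < r) (ht : t ∈ Ioo (-1 : ℝ) 1)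
    {v w : ℝ → ℝ} (hv : MemLp v 2 μI) (hw : MemLp w 2 μI)
    (h : ∀ F : ℕ → ℝ → ℝ, IsChain r (-1) 1 F → MemLp (F r) 2 μI →
      F k t = (∫ x in (-1 : ℝ)..1, v x * F 0 x) + ∫ x in (-1 : ℝ)..1, w x * F r x) :
    ∃ A B : ℕ → ℝ → ℝ, IsSplitChain r k r t A B ∧ A r = v ∧ B r = v ∧
      w =ᵐ[μI] fun x => -(-1) ^ r * glue t (A 0) (B 0) x := by
  have hvi : IntervalIntegrable v volume (-1) 1 := by
    rw [intervalIntegrable_iff_integrableOn_Icc_of_le (by norm_num)]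
    exact hv.integrable one_le_two
  have ht' := Ioo_subset_Icc_self ht
  have hsL : uIcc (-1) t ⊆ uIcc (-1 : ℝ) 1 := by
    rw [uIcc_of_le ht'.1, uIcc_of_le (by norm_num)]; exact Icc_subset_Icc_right ht'.2
  have hsR : uIcc t 1 ⊆ uIcc (-1 : ℝ) 1 := by
    rw [uIcc_of_le ht'.2, uIcc_of_le (by norm_num)]; exact Icc_subset_Icc_left ht'.1
  set A : ℕ → ℝ → ℝ := fun j => (prim (-1))^[r - j] v with hAdef
  set B : ℕ → ℝ → ℝ := fun j => (prim 1)^[r - j] v with hBdef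
  have hA : IsChain r (-1) t A := IsChain.of_prim ⟨le_rfl, ht'.1⟩ (hvi.mono_set hsL) r
  have hB : IsChain r t 1 B := IsChain.of_prim ⟨ht'.2, le_rfl⟩ (hvi.mono_set hsR) r
  have hA0 : ∀ j < r, A j (-1) = 0 := fun j hj => iterate_prim_self _ _ (by omega)
  have hB0 : ∀ j < r, B j 1 = 0 := fun j hj => iterate_prim_self _ _ (by omega)
  have hAr : A r = v := by simp [hAdef]
  have hBr : B r = v := by simp [hBdef]
  have hv' : glue t (A r) (B r) = v := by
    rw [hAr, hBr]; ext x; simp [glue]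
  have hG : MemLp (glue t (A 0) (B 0)) 2 μI := memLp_glue
    (hA.continuousOn ht'.1 (by omega)) (hB.continuousOn ht'.2 (by omega))
  have key : ∀ F : ℕ → ℝ → ℝ, IsChain r (-1) 1 F → MemLp (F r) 2 μI → F k t =
      (∑ j ∈ Finset.range r, (-1) ^ j * (A (r - 1 - j) t - B (r - 1 - j) t) * F j t +
      (-1) ^ r * ∫ x in (-1 : ℝ)..1, glue t (A 0) (B 0) x * F r x) +
      ∫ x in (-1 : ℝ)..1, w x * F r x := by
    intro F hF hFr
    have := integral_by_parts_jump ht' (by omega) hF hA hB hA0 hB0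
    rw [hv'] at this
    rw [← this, ← h F hF hFr]
  have hjump : ∀ i < r, (-1 : ℝ) ^ i * (A (r - 1 - i) t - B (r - 1 - i) t) =
      if i = k then 1 else 0 := by
    intro i hi
    have h1 : Polynomial.derivative^[r] ((Polynomial.X - Polynomial.C t) ^ i) = 0 := by
      rw [Polynomial.iterate_derivative_X_sub_pow, Nat.descFactorial_of_lt hi, zero_smul]
    -- Testing with `(X - t)^i`, `i < r`: the `r`-th derivative vanishes, and among the derivatives
    -- at `t` only that of order `i` is nonzero, which isolates one jump.
    have h2 := key _ (isChain_polynomial ((Polynomial.X - Polynomial.C t) ^ i) r (by norm_num))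
      (by simp [h1])
    simp only [h1, Polynomial.eval_zero, mul_zero, intervalIntegral.integral_zero, add_zero,
      eval_iterate_derivative_X_sub_C_pow] at h2
    simp only [mul_ite, mul_zero] at h2
    rw [Finset.sum_ite_eq' , if_pos (Finset.mem_range.2 hi)] at h2
    have h3 : (i.factorial : ℝ) ≠ 0 := by exact_mod_cast i.factorial_ne_zero
    refine mul_right_cancel₀ h3 (h2.symm.trans ?_)
    by_cases hik : i = k
    · simp [hik]
    · simp [hik, Ne.symm hik]
  refine ⟨A, B, ⟨hA, hB, hA0, hB0, fun j hj => ?_⟩, hAr, hBr, ?_⟩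
  · have h1 := hjump (r - 1 - j) (by omega)
    have h2 : r - 1 - (r - 1 - j) = j := by omega
    rw [h2] at h1
    have h3 : ((-1 : ℝ) ^ (r - 1 - j)) * (-1) ^ (r - 1 - j) = 1 := by rw [← mul_pow]; norm_num
    split_ifs with hjk
    · have h4 : r - 1 - j = k := by omega
      rw [h4] at h1 h3
      rw [if_pos rfl] at h1
      rw [pow_succ]
      linear_combination (-(-1) ^ k) * h1 + (A j t - B j t) * h3
    · rw [if_neg (by omega)] at h1
      linear_combination (-(-1) ^ (r - 1 - j)) * h1 + (A j t - B j t) * h3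
  · set G := glue t (A 0) (B 0) with hGdef
    set d : ℝ → ℝ := fun x => (-1) ^ r * G x + w x with hd
    have hdL : MemLp d 2 μI := (hG.const_mul _).add hw
    have hdi : IntervalIntegrable d volume (-1) 1 := by
      rw [intervalIntegrable_iff_integrableOn_Icc_of_le (by norm_num)]
      exact hdL.integrable one_le_two
    -- With the jumps known, the point values cancel. Testing with the `r`-fold primitive of the
    -- defect `d` then gives `∫ d^2 = 0`.
    have h2 := key _ (IsChain.of_prim (c := -1) (by norm_num) hdi r) (by simpa using hdL)
    have h3 : ∀ F : ℕ → ℝ → ℝ, ∑ j ∈ Finset.range r,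
        (-1) ^ j * (A (r - 1 - j) t - B (r - 1 - j) t) * F j t = F k t := by
      intro F
      rw [Finset.sum_congr rfl fun j hj => by rw [hjump j (Finset.mem_range.1 hj)]]
      simp [hk]
    rw [h3 fun j => (prim (-1))^[r - j] d] at h2
    simp only [Nat.sub_self, Function.iterate_zero, id_eq] at h2
    have iGd : IntervalIntegrable (fun x => G x * d x) volume (-1) 1 := by
      rw [intervalIntegrable_iff_integrableOn_Icc_of_le (by norm_num)]
      exact hG.integrable_mul hdL
    have iwd : IntervalIntegrable (fun x => w x * d x) volume (-1) 1 := by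
      rw [intervalIntegrable_iff_integrableOn_Icc_of_le (by norm_num)]
      exact hw.integrable_mul hdL
    have h4 : ∫ x in (-1 : ℝ)..1, d x * d x = 0 := by
      have e : ∀ x, d x * d x = (-1) ^ r * (G x * d x) + w x * d x := fun x => by
        simp only [hd]; ring
      simp_rw [e]
      rw [intervalIntegral.integral_add (iGd.const_mul _) iwd, intervalIntegral.integral_const_mul]
      linarith
    rw [intervalIntegral.integral_of_le (by norm_num), ← integral_Icc_eq_integral_Ioc,
      integral_eq_zero_iff_of_nonneg (fun x => mul_self_nonneg _) (hdL.integrable_mul hdL)] at h4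
    filter_upwards [h4] with x hx
    have : d x = 0 := by simpa using hx
    simp only [hd] at this
    linarith

/-! ### Tikhonov regularization in Hilbert space -/

section Tikhonov

open ContinuousLinearMap

variable {H K : Type*} [NormedAddCommGroup H] [InnerProductSpace ℝ H] [CompleteSpace H]
  [NormedAddCommGroup K] [InnerProductSpace ℝ K] [CompleteSpace K]

/-- The operator is coercive: its quadratic form is `‖x‖^2 + lam ‖C† x‖^2 ≥ ‖x‖^2`. -/
theorem isUnit_one_add_smul_comp_adjoint (C : K →L[ℝ] H) {lam : ℝ} (hl : 0 ≤ lam) :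
    IsUnit ((1 : H →L[ℝ] H) + lam • (C ∘L adjoint C)) := by
  refine isUnit_of_forall_le_norm_inner_map _ (c := 1) one_pos fun x => ?_
  have e : inner ℝ (((1 : H →L[ℝ] H) + lam • (C ∘L adjoint C)) x) x =
      ‖x‖ ^ 2 + lam * ‖adjoint C x‖ ^ 2 := by
    simp only [add_apply, one_apply_eq_self, smul_apply, comp_apply, inner_add_left,
      inner_smul_left, real_inner_self_eq_norm_sq]
    rw [← adjoint_inner_right, real_inner_self_eq_norm_sq]
    simp
  rw [e, NNReal.coe_one, mul_one]
  exact (le_add_of_nonneg_right (by positivity)).trans (le_abs_self _)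

/-- The Tikhonov regularized solution of the equation `C (e - C† h) = 0`. -/
noncomputable def tikhonov (C : K →L[ℝ] H) (e : K) (lam : ℝ) : H :=
  Ring.inverse ((1 : H →L[ℝ] H) + lam • (C ∘L adjoint C)) (lam • C e)

theorem tikhonov_eq (C : K →L[ℝ] H) (e : K) {lam : ℝ} (hl : 0 ≤ lam) :
    tikhonov C e lam = lam • C (e - adjoint C (tikhonov C e lam)) := by
  have h := Ring.mul_inverse_cancel _ (isUnit_one_add_smul_comp_adjoint C hl)
  have h1 : ((1 : H →L[ℝ] H) + lam • (C ∘L adjoint C)) (tikhonov C e lam) = lam • C e := by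
    have := congrArg (fun f : H →L[ℝ] H => f (lam • C e)) h
    exact this
  simp only [add_apply, one_apply_eq_self, smul_apply, comp_apply] at h1
  rw [map_sub, smul_sub, ← h1]
  abel

theorem continuousOn_tikhonov (C : K →L[ℝ] H) (e : K) :
    ContinuousOn (tikhonov C e) (Ici 0) := by
  intro lam hl
  obtain ⟨x, hx⟩ := isUnit_one_add_smul_comp_adjoint C hl
  have h1 : ContinuousAt (fun l : ℝ => (1 : H →L[ℝ] H) + l • (C ∘L adjoint C)) lam := by
    fun_prop
  have h2 : ContinuousAt (fun l : ℝ => Ring.inverse ((1 : H →L[ℝ] H) + l • (C ∘L adjoint C)))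
      lam := by
    refine ContinuousAt.comp (g := Ring.inverse) ?_ h1
    rw [← hx]
    exact NormedRing.inverse_continuousAt x
  have h3 : ContinuousAt (fun l : ℝ => l • C e) lam := by fun_prop
  exact (h2.clm_apply h3).continuousWithinAt

/-- For `x`, `y` the regularizations at `l ≤ m`, the two equations combine to `m x - l y = l m C C†
(y - x)`. Positivity of `C C†` gives `(m - l) ⟨x, y - x⟩ ≥ l ‖y - x‖^2`, hence `⟨x, y - x⟩ ≥ 0`.
Besides monotonicity of the norm, this makes a bounded family of regularizations Cauchy. -/
theorem norm_tikhonov_sq_add_le (C : K →L[ℝ] H) (e : K) {l m : ℝ} (hl : 0 < l) (hlm : l ≤ m) :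
    ‖tikhonov C e l‖ ^ 2 + ‖tikhonov C e m - tikhonov C e l‖ ^ 2 ≤ ‖tikhonov C e m‖ ^ 2 := by
  have h1 := tikhonov_eq C e hl.le
  have h2 := tikhonov_eq C e (hl.le.trans hlm)
  set x := tikhonov C e l
  set y := tikhonov C e m
  have hm : 0 < m := hl.trans_le hlm
  have h3 : m • x - l • y = (l * m) • C (adjoint C (y - x)) := by
    have : m • x - l • y = (m * l) • C (e - adjoint C x) - (l * m) • C (e - adjoint C y) := by
      rw [mul_smul, mul_smul, ← h1, ← h2]
    rw [this, mul_comm m l, ← smul_sub, ← map_sub]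
    congr 2
    rw [map_sub]
    abel
  have h4 : 0 ≤ inner ℝ (m • x - l • y) (y - x) := by
    rw [h3, inner_smul_left, ← adjoint_inner_right, real_inner_self_eq_norm_sq]
    simp only [conj_trivial]
    positivity
  have h5 : m • x - l • y = (m - l) • x - l • (y - x) := by
    rw [sub_smul, smul_sub]; abel
  rw [h5, inner_sub_left, inner_smul_left, inner_smul_left, real_inner_self_eq_norm_sq] at h4
  simp only [conj_trivial] at h4
  have h6 : ‖y‖ ^ 2 = ‖x‖ ^ 2 + 2 * inner ℝ x (y - x) + ‖y - x‖ ^ 2 := by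
    rw [← norm_add_sq_real]; congr 2; abel
  have h7 : 0 ≤ inner ℝ x (y - x) := by
    by_contra hneg
    have : (m - l) * inner ℝ x (y - x) ≤ 0 :=
      mul_nonpos_of_nonneg_of_nonpos (sub_nonneg.2 hlm) (not_le.1 hneg).le
    have h8 : ‖y - x‖ ^ 2 ≤ 0 := by
      by_contra h9
      have := mul_pos hl (not_le.1 h9)
      linarith
    have h9 : y - x = 0 := by
      have := le_antisymm h8 (sq_nonneg _)
      simpa using this
    exact hneg (by simp [h9])
  linarith

/-- If the equation `C (e - C† h) = 0` has no solution, then its Tikhonov regularizations take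
every norm. -/
theorem exists_tikhonov_norm_eq (C : K →L[ℝ] H) (e : K)
    (hC : ∀ h : H, C (e - adjoint C h) ≠ 0) {c : ℝ} (hc : 0 ≤ c) :
    ∃ lam : ℝ, 0 ≤ lam ∧ ∃ h : H, h = lam • C (e - adjoint C h) ∧ ‖h‖ = c := by
  obtain ⟨l, hl, hlc⟩ : ∃ l : ℝ, 0 ≤ l ∧ c ≤ ‖tikhonov C e l‖ := by
    by_contra! hcon
    set x : ℕ → H := fun n => tikhonov C e (n + 1) with hx
    have hpos : ∀ n : ℕ, (0 : ℝ) < n + 1 := fun n => by positivity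
    have hstep : ∀ m n : ℕ, m ≤ n → ‖x m‖ ^ 2 + ‖x n - x m‖ ^ 2 ≤ ‖x n‖ ^ 2 := fun m n h =>
      norm_tikhonov_sq_add_le C e (hpos m) (by gcongr)
    have hmono : Monotone fun n => ‖x n‖ ^ 2 := fun m n h =>
      (le_add_of_nonneg_right (sq_nonneg _)).trans (hstep m n h)
    have hb : ∀ n, ‖x n‖ < c := fun n => hcon _ (hpos n).le
    have hbdd : BddAbove (range fun n => ‖x n‖ ^ 2) :=
      ⟨c ^ 2, by rintro _ ⟨n, rfl⟩; exact pow_le_pow_left₀ (norm_nonneg _) (hb n).le 2⟩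
    have hcau := (tendsto_atTop_ciSup hmono hbdd).cauchySeq
    have hcx : CauchySeq x := by
      rw [Metric.cauchySeq_iff'] at hcau ⊢
      intro ε hε
      obtain ⟨N, hN⟩ := hcau (ε ^ 2) (by positivity)
      refine ⟨N, fun n hn => ?_⟩
      have h1 := hN n hn
      rw [Real.dist_eq] at h1
      have h2 := (le_abs_self _).trans_lt h1
      have h3 := hstep N n hn
      rw [dist_eq_norm]
      exact lt_of_pow_lt_pow_left₀ 2 hε.le (by linarith)
    obtain ⟨y, hy⟩ := cauchySeq_tendsto_of_complete hcx
    -- Bounded regularizations converge to some `y`; dividing their equation by the parameter, which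
    -- tends to infinity, shows that `y` solves the unsolvable equation.
    refine hC y (tendsto_nhds_unique (f := fun n => C (e - adjoint C (x n))) (l := atTop) ?_ ?_)
    · have : Continuous fun z => C (e - adjoint C z) := by fun_prop
      exact (this.tendsto y).comp hy
    · have h1 : ∀ n : ℕ, C (e - adjoint C (x n)) = ((n : ℝ) + 1)⁻¹ • x n := by
        intro n
        rw [eq_inv_smul_iff₀ (hpos n).ne']
        exact (tikhonov_eq C e (hpos n).le).symm
      simp_rw [h1]
      have h2 : Tendsto (fun n : ℕ => ((n : ℝ) + 1)⁻¹) atTop (𝓝 0) := by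
        simpa using tendsto_one_div_add_atTop_nhds_zero_nat (𝕜 := ℝ)
      simpa using h2.smul hy
  -- The norm is continuous in the parameter and starts at `0`, so the intermediate value theorem
  -- applies.
  have h0 : ‖tikhonov C e 0‖ = 0 := by simp [tikhonov]
  have hiv := intermediate_value_Icc hl ((continuousOn_tikhonov C e).norm.mono Icc_subset_Ici_self)
  obtain ⟨lam, hlam, h⟩ := hiv ⟨h0.trans_le hc, hlc⟩
  exact ⟨lam, hlam.1, _, tikhonov_eq C e hlam.1, h⟩

end Tikhonov

/-! ### Integration as an operator on `L2` -/

theorem intervalIntegral_eq_integral_μI (f : ℝ → ℝ) :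
    ∫ x in (-1 : ℝ)..1, f x = ∫ x, f x ∂μI := by
  rw [intervalIntegral.integral_of_le (by norm_num), ← integral_Icc_eq_integral_Ioc]

theorem inner_eq_intervalIntegral {f g : L2} {f' g' : ℝ → ℝ} (hf : f =ᵐ[μI] f')
    (hg : g =ᵐ[μI] g') : inner ℝ f g = ∫ x in (-1 : ℝ)..1, f' x * g' x := by
  rw [intervalIntegral_eq_integral_μI, L2.inner_def]
  refine integral_congr_ae ?_
  filter_upwards [hf, hg] with x h1 h2
  simp [h1, h2, mul_comm]

theorem intervalIntegrable_of_memLp {f : ℝ → ℝ} (hf : MemLp f 2 μI) :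
    IntervalIntegrable f volume (-1) 1 := by
  rw [intervalIntegrable_iff_integrableOn_Icc_of_le (by norm_num)]
  exact hf.integrable one_le_two

theorem prim_congr {f g : ℝ → ℝ} (h : f =ᵐ[μI] g) {x : ℝ} (hx : x ∈ Icc (-1 : ℝ) 1) :
    prim (-1) f x = prim (-1) g x :=
  intervalIntegral_congr_Ioo hx.1
    (ae_of_ae h (Ioo_subset_Icc_self.trans (Icc_subset_Icc_right hx.2)))

theorem continuousOn_prim {f : ℝ → ℝ} (hf : MemLp f 2 μI) :
    ContinuousOn (prim (-1) f) (Icc (-1) 1) :=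
  (isPrim_prim (by norm_num) (intervalIntegrable_of_memLp hf)).continuousOn (by norm_num)

/-- The representer in `L2` of integration from `-1` to `x`. -/
noncomputable def stepL2 (x : ℝ) : L2 :=
  indicatorConstLp 2 (μ := μI) (s := Ioc (-1) x) measurableSet_Ioc (measure_ne_top _ _) 1

theorem inner_stepL2 (g : L2) {x : ℝ} (hx : x ∈ Icc (-1 : ℝ) 1) :
    inner ℝ (stepL2 x) g = prim (-1) g x := by
  rw [stepL2, L2.inner_indicatorConstLp_one, prim, intervalIntegral.integral_of_le hx.1,
    Measure.restrict_restrict measurableSet_Ioc, inter_eq_left.2]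
  exact Ioc_subset_Icc_self.trans (Icc_subset_Icc_right hx.2)

theorem exists_norm_stepL2_le : ∃ C : ℝ, 0 ≤ C ∧ ∀ x, ‖stepL2 x‖ ≤ C := by
  refine ⟨μI.real univ ^ (1 / (2 : ℝ≥0∞).toReal), by positivity, fun x => ?_⟩
  refine norm_indicatorConstLp_le.trans ?_
  rw [norm_one, one_mul]
  exact Real.rpow_le_rpow measureReal_nonneg (measureReal_mono (subset_univ _)) (by simp)

/-- The operator of integration from `-1` on `L2`. -/
noncomputable def intOp : L2 →L[ℝ] L2 :=
  LinearMap.mkContinuousOfExistsBound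
    { toFun := fun g => (memLp_of_continuousOn (continuousOn_prim (Lp.memLp g))).toLp
      map_add' := fun f g => by
        rw [← MemLp.toLp_add]
        refine MemLp.toLp_congr _ _ ?_
        refine (ae_restrict_iff' measurableSet_Icc).2 (Eventually.of_forall fun x hx => ?_)
        rw [Pi.add_apply, ← inner_stepL2 f hx, ← inner_stepL2 g hx, ← inner_stepL2 _ hx,
          inner_add_right]
      map_smul' := fun c g => by
        rw [RingHom.id_apply, ← MemLp.toLp_const_smul]
        refine MemLp.toLp_congr _ _ ?_
        refine (ae_restrict_iff' measurableSet_Icc).2 (Eventually.of_forall fun x hx => ?_)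
        rw [Pi.smul_apply, ← inner_stepL2 g hx, ← inner_stepL2 _ hx, inner_smul_right,
          smul_eq_mul] }
    (by
      obtain ⟨C, hC, h⟩ := exists_norm_stepL2_le
      refine ⟨(measureUnivNNReal μI : ℝ) ^ (2 : ℝ≥0∞).toReal⁻¹ * C, fun g => ?_⟩
      rw [mul_assoc]
      refine Lp.norm_le_of_ae_bound (by positivity) ?_
      filter_upwards [MemLp.coeFn_toLp (memLp_of_continuousOn (continuousOn_prim (Lp.memLp g))),
        ae_restrict_mem measurableSet_Icc] with x hx hxI
      simp only [LinearMap.coe_mk, AddHom.coe_mk]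
      rw [hx, ← inner_stepL2 g hxI]
      exact (norm_inner_le_norm _ _).trans (mul_le_mul_of_nonneg_right (h x) (norm_nonneg _)))

theorem coeFn_intOp (g : L2) : intOp g =ᵐ[μI] prim (-1) g :=
  MemLp.coeFn_toLp (memLp_of_continuousOn (continuousOn_prim (Lp.memLp g)))

theorem coeFn_intOp_pow (n : ℕ) (g : L2) : (intOp ^ n) g =ᵐ[μI] (prim (-1))^[n] g := by
  induction n with
  | zero => exact EventuallyEq.rfl
  | succ n ih =>
    rw [pow_succ', Function.iterate_succ_apply']
    refine (coeFn_intOp _).trans ?_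
    exact (ae_restrict_iff' measurableSet_Icc).2 (Eventually.of_forall fun x hx =>
      prim_congr ih hx)

theorem inner_stepL2_intOp_pow (n : ℕ) (g : L2) {x : ℝ} (hx : x ∈ Icc (-1 : ℝ) 1) :
    inner ℝ (stepL2 x) ((intOp ^ n) g) = (prim (-1))^[n + 1] g x := by
  rw [inner_stepL2 _ hx, Function.iterate_succ_apply']
  exact prim_congr (coeFn_intOp_pow n g) hx

theorem iterate_prim_congr {f g : ℝ → ℝ} (h : f =ᵐ[μI] g) {n : ℕ} (hn : 0 < n) {x : ℝ}
    (hx : x ∈ Icc (-1 : ℝ) 1) : (prim (-1))^[n] f x = (prim (-1))^[n] g x := by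
  obtain ⟨n, rfl⟩ := Nat.exists_eq_succ_of_ne_zero hn.ne'
  clear hn
  induction n generalizing x with
  | zero => exact prim_congr h hx
  | succ n ih =>
    rw [Function.iterate_succ_apply' _ (n + 1) f, Function.iterate_succ_apply' _ (n + 1) g]
    exact prim_congr ((ae_restrict_iff' measurableSet_Icc).2 (Eventually.of_forall fun y hy =>
      ih hy)) hx

/-! ### Polynomials in `L2` and the constant `M_t` -/

/-- A polynomial as an element of `L2`. -/
noncomputable def polyL2 : Polynomial ℝ →ₗ[ℝ] L2 where
  toFun p := (memLp_of_continuousOn (a := -1) (b := 1) p.continuousOn).toLp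
  map_add' p q := by
    rw [← MemLp.toLp_add]
    exact MemLp.toLp_congr _ _ (Eventually.of_forall fun x => by simp)
  map_smul' c p := by
    rw [RingHom.id_apply, ← MemLp.toLp_const_smul]
    exact MemLp.toLp_congr _ _ (Eventually.of_forall fun x => by simp)

theorem coeFn_polyL2 (p : Polynomial ℝ) : polyL2 p =ᵐ[μI] fun x => p.eval x :=
  MemLp.coeFn_toLp (memLp_of_continuousOn (a := -1) (b := 1) p.continuousOn)

theorem norm_polyL2 (p : Polynomial ℝ) :
    ‖polyL2 p‖ = (eLpNorm (fun x => p.eval x) 2 μI).toReal :=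
  Lp.norm_toLp _ (memLp_of_continuousOn (a := -1) (b := 1) p.continuousOn)

theorem polyL2_injective : Function.Injective polyL2 := by
  rw [← LinearMap.ker_eq_bot, LinearMap.ker_eq_bot']
  intro p hp
  have h1 : (fun x => p.eval x) =ᵐ[volume.restrict (Icc (-1 : ℝ) 1)] fun _ => (0 : ℝ) := by
    refine (coeFn_polyL2 p).symm.trans ?_
    rw [hp]
    exact Lp.coeFn_zero _ _ _
  have h2 := Measure.eqOn_Icc_of_ae_eq volume (by norm_num) h1 p.continuousOn continuousOn_const
  exact Polynomial.eq_zero_of_infinite_isRoot p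
    ((Icc_infinite (by norm_num : (-1 : ℝ) < 1)).mono fun x hx => h2 hx)

/-- The subspace of `L2` of the polynomials of degree less than `r`. -/
noncomputable abbrev polySubspace (r : ℕ) : Submodule ℝ L2 := (Polynomial.degreeLT ℝ r).map polyL2

instance (r : ℕ) : FiniteDimensional ℝ (Polynomial.degreeLT ℝ r) :=
  (Polynomial.degreeLTEquiv ℝ r).symm.finiteDimensional

/-- Riesz representation on the finite-dimensional space of polynomials. The left inverse `g`
recovers a polynomial from its class, so that its derivative at a point makes sense. -/
theorem exists_derivative_representer (r k : ℕ) (t : ℝ) :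
    ∃ q ∈ polySubspace r, ∀ p ∈ Polynomial.degreeLT ℝ r,
      inner ℝ q (polyL2 p) = (Polynomial.derivative^[k] p).eval t := by
  obtain ⟨g, hg⟩ := polyL2.exists_leftInverse_of_injective
    (LinearMap.ker_eq_bot.2 polyL2_injective)
  let D : polySubspace r →ₗ[ℝ] ℝ :=
    (Polynomial.leval t ∘ₗ (Polynomial.derivative ^ k)) ∘ₗ g ∘ₗ (polySubspace r).subtype
  let q := (InnerProductSpace.toDual ℝ (polySubspace r)).symm (LinearMap.toContinuousLinearMap D)
  refine ⟨q, q.2, fun p hp => ?_⟩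
  have h1 : inner ℝ q ⟨polyL2 p, Submodule.mem_map_of_mem hp⟩ =
      D ⟨polyL2 p, Submodule.mem_map_of_mem hp⟩ := by
    simp [q, InnerProductSpace.toDual_symm_apply]
  have h2 : g (polyL2 p) = p := congrArg (fun f => f p) hg
  rw [Submodule.coe_inner] at h1
  rw [h1]
  simp [D, h2, Polynomial.leval, Module.End.pow_apply]

theorem iterate_derivative_eq_zero_of_mem_degreeLT {r : ℕ} {p : Polynomial ℝ}
    (hp : p ∈ Polynomial.degreeLT ℝ r) : Polynomial.derivative^[r] p = 0 := by
  rw [Polynomial.mem_degreeLT] at hp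
  rcases eq_or_ne p 0 with rfl | h0
  · simp
  · exact Polynomial.iterate_derivative_eq_zero ((Polynomial.natDegree_lt_iff_degree_lt h0).2 hp)

theorem markovConst_nonneg (r k : ℕ) (t : ℝ) : 0 ≤ markovConst r k t :=
  Real.sInf_nonneg fun _ h => h.1

/-- Testing an admissible constant with the polynomial `q` itself gives `‖q‖^2 ≤ M ‖q‖`. By
Cauchy-Schwarz `‖q‖` is admissible, so the infimum is over a nonempty set. -/
theorem norm_representer_le_markovConst {r k : ℕ} {t : ℝ} {q : L2} (hq : q ∈ polySubspace r)
    (h : ∀ p ∈ Polynomial.degreeLT ℝ r,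
      inner ℝ q (polyL2 p) = (Polynomial.derivative^[k] p).eval t) :
    ‖q‖ ≤ markovConst r k t := by
  refine le_csInf ⟨‖q‖, norm_nonneg _, fun p hp => ?_⟩ ?_
  · rw [← norm_polyL2, ← h p hp]
    exact abs_real_inner_le_norm _ _
  · rintro M ⟨hM, hMp⟩
    obtain ⟨p, hp, rfl⟩ := hq
    have h1 := hMp p hp
    rw [← norm_polyL2, ← h p hp, real_inner_self_eq_norm_sq, abs_of_nonneg (sq_nonneg _)] at h1
    rcases (norm_nonneg (polyL2 p)).eq_or_lt with h0 | h0
    · rw [← h0]; exact hM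
    · rw [sq] at h1
      exact le_of_mul_le_mul_right h1 h0

/-! ### Existence of solutions -/

/-- Taylor's formula for chains, with the remainder as an iterated integral. -/
theorem IsChain.exists_taylor {r : ℕ} {F : ℕ → ℝ → ℝ} (hF : IsChain r (-1) 1 F)
    (hL : IntervalIntegrable (F r) volume (-1) 1) :
    ∃ p ∈ Polynomial.degreeLT ℝ r, ∀ j ≤ r, ∀ x ∈ Icc (-1 : ℝ) 1,
      F j x = (Polynomial.derivative^[j] p).eval x + (prim (-1))^[r - j] (F r) x := by
  let p : Polynomial ℝ := ∑ i ∈ Finset.range r,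
    Polynomial.C (F i (-1) / i.factorial) * (Polynomial.X - Polynomial.C (-1)) ^ i
  have hp : p ∈ Polynomial.degreeLT ℝ r := by
    refine Submodule.sum_mem _ fun i hi => ?_
    rw [← Polynomial.smul_eq_C_mul]
    refine Submodule.smul_mem _ _ ?_
    rw [Polynomial.mem_degreeLT, Polynomial.degree_pow, Polynomial.degree_X_sub_C,
      nsmul_one]
    exact_mod_cast Finset.mem_range.1 hi
  have hp' : ∀ j < r, (Polynomial.derivative^[j] p).eval (-1) = F j (-1) := by
    intro j hj
    simp only [p, Polynomial.iterate_derivative_sum, Polynomial.iterate_derivative_C_mul,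
      Polynomial.eval_finsetSum, Polynomial.eval_mul, Polynomial.eval_C,
      eval_iterate_derivative_X_sub_C_pow, mul_ite, mul_zero]
    rw [Finset.sum_ite_eq, if_pos (Finset.mem_range.2 hj)]
    have : (j.factorial : ℝ) ≠ 0 := by exact_mod_cast j.factorial_ne_zero
    field_simp
  refine ⟨p, hp, fun j hj => ?_⟩
  have hP := isChain_polynomial p r (a := -1) (b := 1) (by norm_num)
  have hR := IsChain.of_prim (a := -1) (b := 1) (c := -1) (by norm_num) hL r
  refine Nat.decreasingInduction (motive := fun j _ => ∀ x ∈ Icc (-1 : ℝ) 1,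
    F j x = (Polynomial.derivative^[j] p).eval x + (prim (-1))^[r - j] (F r) x)
    (fun j hj ih x hx => ?_) (fun x _ => ?_) hj
  · have hS := (hP j hj).add (hR j hj) (by norm_num)
    have hS2 := hS.2 x hx
    simp only at hS2
    rw [(hF j hj).2 x hx, hS2, hp' j hj, iterate_prim_self _ _ (by omega), add_zero]
    congr 1
    refine intervalIntegral.integral_congr fun y hy => ih y ?_
    rw [uIcc_of_le hx.1] at hy
    exact ⟨hy.1, hy.2.trans hx.2⟩
  · simp [iterate_derivative_eq_zero_of_mem_degreeLT hp]

/-- By Taylor's formula `F 0` is a polynomial plus the `r`-fold integral of `F r`. On the polynomial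
`q` reproduces the derivative and `h` vanishes; on the remainder the claim is the hypothesis on `w`.
-/
theorem integral_eq_weak {r k : ℕ} {t : ℝ} (hk : k < r) (ht : t ∈ Ioo (-1 : ℝ) 1) {q h w : L2}
    (hq : ∀ p ∈ Polynomial.degreeLT ℝ r,
      inner ℝ q (polyL2 p) = (Polynomial.derivative^[k] p).eval t)
    (hh : h ∈ (polySubspace r)ᗮ)
    (hw : ∀ g : L2, inner ℝ w g = (prim (-1))^[r - k] g t - inner ℝ (q + h) ((intOp ^ r) g))
    {F : ℕ → ℝ → ℝ} (hF : IsChain r (-1) 1 F) (hFr : MemLp (F r) 2 μI) :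
    F k t = (∫ x in (-1 : ℝ)..1, (q + h) x * F 0 x) + ∫ x in (-1 : ℝ)..1, w x * F r x := by
  obtain ⟨p, hp, hpF⟩ := hF.exists_taylor (intervalIntegrable_of_memLp hFr)
  set g : L2 := hFr.toLp with hg
  have hgF : g =ᵐ[μI] F r := hFr.coeFn_toLp
  have h0 : polyL2 p + (intOp ^ r) g =ᵐ[μI] F 0 := by
    filter_upwards [Lp.coeFn_add (polyL2 p) ((intOp ^ r) g), coeFn_polyL2 p, coeFn_intOp_pow r g,
      ae_restrict_mem measurableSet_Icc] with x h1 h2 h3 hx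
    rw [h1, Pi.add_apply, h2, h3, hpF 0 (Nat.zero_le _) x hx,
      iterate_prim_congr hgF (by omega) hx]
    rfl
  rw [← inner_eq_intervalIntegral (f := q + h) EventuallyEq.rfl h0,
    ← inner_eq_intervalIntegral (f := w) EventuallyEq.rfl hgF, hw,
    hpF k hk.le t (Ioo_subset_Icc_self ht),
    iterate_prim_congr hgF (by omega) (Ioo_subset_Icc_self ht), inner_add_right, inner_add_left,
    hq p hp, Submodule.inner_left_of_mem_orthogonal (Submodule.mem_map_of_mem hp) hh]
  ring

theorem eqOn_zero_of_ae {a b : ℝ} (hab : a < b) {f : ℝ → ℝ} (hf : ContinuousOn f (Icc a b))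
    (h : f =ᵐ[volume.restrict (Ioo a b)] 0) : EqOn 0 f (Icc a b) := by
  rw [Measure.restrict_congr_set Ioo_ae_eq_Icc] at h
  exact (Measure.eqOn_Icc_of_ae_eq volume hab.ne h hf continuousOn_const).symm

theorem IsChain.eqOn_zero {m : ℕ} {a b : ℝ} {F : ℕ → ℝ → ℝ} (hF : IsChain m a b F) (hab : a < b)
    (h : F 0 =ᵐ[volume.restrict (Ioo a b)] 0) {j : ℕ} (hj : j < m) {x : ℝ} (hx : x ∈ Icc a b) :
    F j x = 0 := by
  have h0 := eqOn_zero_of_ae hab (hF.continuousOn hab.le (by omega)) h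
  rw [← hF.iteratedDerivWithin_eqOn hab h0 hj.le (hF.continuousOn hab.le hj) hx]
  have : (0 : ℝ → ℝ) = fun _ => 0 := rfl
  rw [this, iteratedDerivWithin_const]
  simp

/-- The function of the weak problem cannot vanish, because of its jump. -/
theorem ne_zero_of_weak {r k : ℕ} {t : ℝ} (hk : k < r) (ht : t ∈ Ioo (-1 : ℝ) 1) {q h w : L2}
    (hq : ∀ p ∈ Polynomial.degreeLT ℝ r,
      inner ℝ q (polyL2 p) = (Polynomial.derivative^[k] p).eval t)
    (hh : h ∈ (polySubspace r)ᗮ)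
    (hw : ∀ g : L2, inner ℝ w g = (prim (-1))^[r - k] g t - inner ℝ (q + h) ((intOp ^ r) g)) :
    w ≠ 0 := by
  rintro rfl
  obtain ⟨A, B, hAB, -, -, hG⟩ := exists_isSplitChain_of_weak hk ht (Lp.memLp (q + h))
    (Lp.memLp (0 : L2)) fun F hF hFr => integral_eq_weak hk ht hq hh hw hF hFr
  have hG0 : glue t (A 0) (B 0) =ᵐ[μI] 0 := by
    filter_upwards [hG, Lp.coeFn_zero ℝ 2 μI] with x h1 h2
    rw [h2] at h1
    have : ((-1 : ℝ) ^ r) ≠ 0 := pow_ne_zero _ (by norm_num)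
    simpa [this] using h1.symm
  have hA : A 0 =ᵐ[volume.restrict (Ioo (-1) t)] 0 := glue_ae_left.symm.trans
    (ae_of_ae hG0 (Ioo_subset_Icc_self.trans (Icc_subset_Icc_right ht.2.le)))
  have hB : B 0 =ᵐ[volume.restrict (Ioo t 1)] 0 := glue_ae_right.symm.trans
    (ae_of_ae hG0 (Ioo_subset_Icc_self.trans (Icc_subset_Icc_left ht.1.le)))
  have h1 := hAB.jump (r - 1 - k) (by omega)
  rw [hAB.left.eqOn_zero ht.1 hA (by omega) ⟨ht.1.le, le_rfl⟩,
    hAB.right.eqOn_zero ht.2 hB (by omega) ⟨le_rfl, ht.2.le⟩, if_pos (by omega), sub_zero] at h1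
  exact pow_ne_zero _ (by norm_num) h1.symm

/-- The `r`-th derivative of the iterated integral is `w` almost everywhere, and that of a
polynomial of degree below `r` is zero. -/
theorem eq_zero_of_intOp_pow_mem {r : ℕ} (hr : 1 ≤ r) {w : L2}
    (h : (intOp ^ r) w ∈ polySubspace r) : w = 0 := by
  obtain ⟨p, hp, hpw⟩ := h
  have hc := IsChain.of_prim (a := -1) (b := 1) (c := -1) (by norm_num)
    (intervalIntegrable_of_memLp (Lp.memLp w)) r
  have h1 : EqOn (fun x => p.eval x) ((prim (-1))^[r - 0] w) (Icc (-1) 1) := by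
    refine Measure.eqOn_Icc_of_ae_eq volume (by norm_num) ?_ p.continuousOn
      (hc.continuousOn (by norm_num) (by omega))
    refine (coeFn_polyL2 p).symm.trans ?_
    rw [hpw]
    exact coeFn_intOp_pow r w
  have h2 := hc.iteratedDerivWithin_ae (by norm_num) h1 hr
  have h3 := (isChain_polynomial p r (a := -1) (b := 1) (by norm_num)).iteratedDerivWithin_ae
    (by norm_num) (eqOn_refl (fun x => p.eval x) _) hr
  simp only [iterate_derivative_eq_zero_of_mem_degreeLT hp, Nat.sub_self, Function.iterate_zero,
    id_eq, Polynomial.eval_zero] at h2 h3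
  exact (Lp.eq_zero_iff_ae_eq_zero).2 (h2.symm.trans h3)

/-- The weak form of the existence part. -/
theorem exists_weak_solution {r k : ℕ} {t N : ℝ} (hk : k < r) (ht : t ∈ Ioo (-1 : ℝ) 1)
    (hN : markovConst r k t ≤ N) :
    ∃ lam : ℝ, 0 ≤ lam ∧ ∃ v w : L2, ‖v‖ = N ∧
      (∃ p ∈ Polynomial.degreeLT ℝ r, v = polyL2 p + lam • (intOp ^ r) w) ∧
      ∀ F : ℕ → ℝ → ℝ, IsChain r (-1) 1 F → MemLp (F r) 2 μI →
        F k t = (∫ x in (-1 : ℝ)..1, v x * F 0 x) + ∫ x in (-1 : ℝ)..1, w x * F r x := by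
  have hN0 : 0 ≤ N := (markovConst_nonneg r k t).trans hN
  obtain ⟨q, hqP, hq⟩ := exists_derivative_representer r k t
  have hqN : ‖q‖ ≤ N := (norm_representer_le_markovConst hqP hq).trans hN
  let P := (polySubspace r)ᗮ
  let C : L2 →L[ℝ] L2 := P.starProjection ∘L (intOp ^ r)
  -- `e` represents the residual of `q` as a functional of the `r`-th derivative; replacing `q` by
  -- `q + h` with `h ∈ P` subtracts `C† h`.
  let e : L2 := ContinuousLinearMap.adjoint (intOp ^ (r - k - 1)) (stepL2 t) -
    ContinuousLinearMap.adjoint (intOp ^ r) q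
  have hw : ∀ h g : L2, inner ℝ (e - ContinuousLinearMap.adjoint C h) g =
      (prim (-1))^[r - k] g t - inner ℝ (q + P.starProjection h) ((intOp ^ r) g) := by
    intro h g
    have hrk : r - k = r - k - 1 + 1 := by omega
    rw [hrk, ← inner_stepL2_intOp_pow _ _ (Ioo_subset_Icc_self ht)]
    simp only [e, C, inner_sub_left, inner_add_left, ContinuousLinearMap.adjoint_inner_left,
      ContinuousLinearMap.comp_apply]
    rw [Submodule.inner_starProjection_left_eq_right]
    ring
  have hC : ∀ h : L2, C (e - ContinuousLinearMap.adjoint C h) ≠ 0 := by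
    intro h h0
    refine ne_zero_of_weak hk ht hq (P.starProjection_apply_mem h) (hw h) ?_
    refine eq_zero_of_intOp_pow_mem (r := r) (by omega) ?_
    have h1 := (Submodule.starProjection_apply_eq_zero_iff P).1 h0
    rwa [Submodule.orthogonal_orthogonal] at h1
  -- Since `h` will be orthogonal to `q`, this norm of `h` gives `‖q + h‖ = N` by Pythagoras.
  obtain ⟨lam, hlam, h, hh, hnorm⟩ := exists_tikhonov_norm_eq C e hC
    (Real.sqrt_nonneg (N ^ 2 - ‖q‖ ^ 2))
  have hhP : h ∈ P := by
    rw [hh]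
    exact P.smul_mem _ (P.starProjection_apply_mem _)
  set w := e - ContinuousLinearMap.adjoint C h with hwdef
  have hww := hw h
  rw [Submodule.starProjection_eq_self_iff.2 hhP] at hww
  refine ⟨lam, hlam, q + h, w, ?_, ?_, fun F hF hFr =>
    integral_eq_weak hk ht hq hhP hww hF hFr⟩
  · have h1 : inner ℝ q h = 0 := Submodule.inner_right_of_mem_orthogonal hqP hhP
    have h2 := norm_add_sq_eq_norm_sq_add_norm_sq_real h1
    rw [hnorm, Real.mul_self_sqrt (sub_nonneg.2 (pow_le_pow_left₀ (norm_nonneg _) hqN 2))] at h2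
    exact (mul_self_inj_of_nonneg (norm_nonneg _) hN0).1 (by rw [h2]; ring)
  · have h1 : (intOp ^ r) w - P.starProjection ((intOp ^ r) w) ∈ polySubspace r := by
      have := Submodule.sub_starProjection_mem_orthogonal (K := P) ((intOp ^ r) w)
      rwa [Submodule.orthogonal_orthogonal] at this
    have h2 : q - lam • ((intOp ^ r) w - P.starProjection ((intOp ^ r) w)) ∈ polySubspace r :=
      Submodule.sub_mem _ hqP (Submodule.smul_mem _ _ h1)
    obtain ⟨p, hp, hpe⟩ := h2
    refine ⟨p, hp, ?_⟩
    have h3 : h = lam • P.starProjection ((intOp ^ r) w) := hh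
    rw [hpe, smul_sub, ← h3]
    abel

theorem exists_isSolution {r k : ℕ} {t N : ℝ} (hk : k < r) (ht : t ∈ Ioo (-1 : ℝ) 1)
    (hN : markovConst r k t ≤ N) :
    ∃ lam : ℝ, 0 ≤ lam ∧ ∃ u : ℝ → ℝ, IsSolution r k t lam u ∧
      eLpNorm (iteratedDeriv r u) 2 μI = ENNReal.ofReal N := by
  have ht' := Ioo_subset_Icc_self ht
  obtain ⟨lam, hlam, v, w, hv, ⟨p, hp, hpv⟩, hweak⟩ := exists_weak_solution hk ht hN
  -- A continuous representative of `v` and its derivatives; the last one, `V r`, is `lam * w`.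
  set V : ℕ → ℝ → ℝ := fun j x =>
    (Polynomial.derivative^[j] p).eval x + lam * (prim (-1))^[r - j] w x with hV
  have hVc : IsChain r (-1) 1 V := fun j hj =>
    (isChain_polynomial p r (by norm_num) j hj).add
      ((IsChain.of_prim (c := -1) (by norm_num) (intervalIntegrable_of_memLp (Lp.memLp w)) r j
        hj).const_mul lam (by norm_num)) (by norm_num)
  have hV0 : v =ᵐ[μI] V 0 := by
    rw [hpv]
    filter_upwards [Lp.coeFn_add (polyL2 p) (lam • (intOp ^ r) w), coeFn_polyL2 p,
      coeFn_intOp_pow r w, Lp.coeFn_smul lam ((intOp ^ r) w)] with x h1 h2 h3 h4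
    rw [h1, Pi.add_apply, h2, h4, Pi.smul_apply, h3]
    rfl
  have hVr : ∀ x, V r x = lam * w x := fun x => by
    simp [hV, iterate_derivative_eq_zero_of_mem_degreeLT hp]
  obtain ⟨A, B, hAB, hAr, hBr, hG⟩ := exists_isSplitChain_of_weak hk ht
    (v := V 0) (w := w) (memLp_of_continuousOn (hVc.continuousOn (by norm_num) (by omega))) (Lp.memLp w) (by
      intro F hF hFr
      rw [hweak F hF hFr]
      congr 1
      rw [intervalIntegral_eq_integral_μI, intervalIntegral_eq_integral_μI]
      exact integral_congr_ae (hV0.mul EventuallyEq.rfl))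
  -- Each half of `u` has `V 0` as its member of order `r`, so the chain continues with `V`, common
  -- to both halves and hence free of jumps. The top member is only prescribed almost everywhere and
  -- is chosen so that the equation holds at every point.
  let ext : (ℕ → ℝ → ℝ) → ℕ → ℝ → ℝ := fun D j =>
    if j < r then D j else if j < 2 * r then V (j - r) else fun x => -(-1) ^ r * lam * D 0 x
  have ext_lt : ∀ D : ℕ → ℝ → ℝ, ∀ j < r, ext D j = D j := fun D j hj => if_pos hj
  have ext_ge : ∀ D : ℕ → ℝ → ℝ, ∀ j, r ≤ j → j < 2 * r → ext D j = V (j - r) :=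
    fun D j hj hj' => by simp only [ext]; rw [if_neg (by omega), if_pos hj']
  have ext_top : ∀ D : ℕ → ℝ → ℝ, ext D (2 * r) = fun x => -(-1) ^ r * lam * D 0 x :=
    fun D => by simp only [ext]; rw [if_neg (by omega), if_neg (by omega)]
  have ext_chain : ∀ {a b : ℝ} {D : ℕ → ℝ → ℝ}, a ∈ Icc (-1 : ℝ) 1 → b ∈ Icc (-1 : ℝ) 1 → a ≤ b →
      IsChain r a b D → D r = V 0 → w =ᵐ[volume.restrict (Ioo a b)] (fun x => -(-1) ^ r * D 0 x) →
      IsChain (2 * r) a b (ext D) := by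
    intro a b D ha hb hab hD hDr hw j hj
    rcases lt_or_ge j r with h | h
    · rw [ext_lt D j h]
      have : ext D (j + 1) = D (j + 1) := by
        rcases (Nat.succ_le_of_lt h).lt_or_eq with h' | h'
        · exact ext_lt D _ h'
        · have h'' : j + 1 = r := h'
          rw [h'', ext_ge D r le_rfl (by omega), Nat.sub_self, hDr]
      rw [this]
      exact hD j h
    · rw [ext_ge D j h hj]
      have hj1 := (hVc (j - r) (by omega)).mono ha hb
      rcases (Nat.succ_le_of_lt hj).lt_or_eq with h' | h'
      · rw [ext_ge D (j + 1) (by omega) h', Nat.sub_add_comm h]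
        exact hj1
      · have h'' : j + 1 = 2 * r := h'
        rw [h'', ext_top]
        refine hj1.congr (eqOn_refl _ _) ?_ hab
        have h3 : j - r + 1 = r := by omega
        rw [h3]
        filter_upwards [hw] with x hx
        rw [hVr, hx]
        ring
  have hA := ext_chain ⟨le_rfl, by norm_num⟩ ht' ht'.1 hAB.left hAr (by
    filter_upwards [ae_of_ae hG (Ioo_subset_Icc_self.trans (Icc_subset_Icc_right ht'.2)),
      glue_ae_left (t := t) (f := A 0) (g := B 0)] with x h1 h2
    rw [h1, h2])
  have hB := ext_chain ht' ⟨by norm_num, le_rfl⟩ ht'.2 hAB.right hBr (by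
    filter_upwards [ae_of_ae hG (Ioo_subset_Icc_self.trans (Icc_subset_Icc_left ht'.1)),
      glue_ae_right (t := t) (f := A 0) (g := B 0)] with x h1 h2
    rw [h1, h2])
  have hS : IsSplitChain r k (2 * r) t (ext A) (ext B) := by
    refine ⟨hA, hB, fun j hj => ?_, fun j hj => ?_, fun j hj => ?_⟩
    · rw [ext_lt A j hj, hAB.zero_left j hj]
    · rw [ext_lt B j hj, hAB.zero_right j hj]
    · rcases lt_or_ge j r with h | h
      · rw [ext_lt A j h, ext_lt B j h, hAB.jump j h]
      · rw [ext_ge A j h hj, ext_ge B j h hj, if_neg (by omega), sub_self]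
  have hode : ∀ D : ℕ → ℝ → ℝ, ∀ x, (-1) ^ r * ext D (2 * r) x + lam * ext D 0 x = 0 := by
    intro D x
    rw [ext_top, ext_lt D 0 (by omega)]
    have h1 : ((-1 : ℝ) ^ r) * (-1) ^ r = 1 := by rw [← mul_pow]; norm_num
    linear_combination (-lam * D 0 x) * h1
  obtain ⟨hsol, eA, eB⟩ := hS.isSolution (by omega) ht (hode A) (hode B)
  refine ⟨lam, hlam, _, hsol, ?_⟩
  have hr0 : ∀ D : ℕ → ℝ → ℝ, ext D r = V 0 := fun D => by
    rw [ext_ge D r le_rfl (by omega), Nat.sub_self]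
  have hae : iteratedDeriv r (glue t (ext A 0) (ext B 0)) =ᵐ[μI] v := by
    have : iteratedDeriv r (glue t (ext A 0) (ext B 0)) =ᵐ[μI] V 0 := by
      refine ae_of_halves (t := t) ?_ ?_
      · refine (ae_restrict_iff' measurableSet_Ioo).2 (Eventually.of_forall fun x hx => ?_)
        rw [eA r (by omega) hx, hr0]
      · refine (ae_restrict_iff' measurableSet_Ioo).2 (Eventually.of_forall fun x hx => ?_)
        rw [eB r (by omega) hx, hr0]
    exact this.trans hV0.symm
  rw [eLpNorm_congr_ae hae, ← hv, Lp.norm_def, ENNReal.ofReal_toReal (Lp.eLpNorm_ne_top v)]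

/-! ### Deviation of the functional and its optimality -/

/-- Collects what optimality needs: the identity for point derivatives, and the fact that `u^(r)` is
itself an admissible test function up to scaling. The only nonzero jump has order `r - k - 1 < r`,
so the derivatives from order `r` on glue to a chain on all of `[-1, 1]`. -/
theorem IsSolution.exists_L2 {r k : ℕ} {t lam N : ℝ} {u : ℝ → ℝ} (hk : k < r)
    (ht : t ∈ Ioo (-1 : ℝ) 1) (h : IsSolution r k t lam u) (hN : 0 ≤ N)
    (huN : eLpNorm (iteratedDeriv r u) 2 μI = ENNReal.ofReal N) :
    ∃ U V : L2, U =ᵐ[μI] u ∧ V =ᵐ[μI] iteratedDeriv r u ∧ ‖V‖ = N ∧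
      (∀ F : ℕ → ℝ → ℝ, IsChain r (-1) 1 F → F k t =
        (∫ x in (-1 : ℝ)..1, V x * F 0 x) - (-1) ^ r * ∫ x in (-1 : ℝ)..1, U x * F r x) ∧
      ∃ F : ℕ → ℝ → ℝ, IsChain r (-1) 1 F ∧ V =ᵐ[μI] F 0 ∧
        F r =ᵐ[μI] fun x => -(-1) ^ r * lam * U x := by
  have ht' := Ioo_subset_Icc_self ht
  obtain ⟨A, B, hAB, eA, eB⟩ := h.exists_isSplitChain (by omega) ht
  have hG : ∀ j, iteratedDeriv j u =ᵐ[μI] glue t (A j) (B j) := by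
    intro j
    refine ae_of_halves (t := t) ?_ ?_
    · refine (ae_restrict_iff' measurableSet_Ioo).2 (Eventually.of_forall fun x hx => ?_)
      rw [eA j hx, glue_of_le hx.2.le]
    · refine (ae_restrict_iff' measurableSet_Ioo).2 (Eventually.of_forall fun x hx => ?_)
      rw [eB j hx, glue_of_lt hx.1]
  have hmem : ∀ j < 2 * r, MemLp (iteratedDeriv j u) 2 μI := fun j hj =>
    (memLp_glue (hAB.left.continuousOn ht'.1 hj) (hAB.right.continuousOn ht'.2 hj)).ae_eq (hG j).symm
  have hU := (hmem 0 (by omega)).coeFn_toLp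
  have hV := (hmem r (by omega)).coeFn_toLp
  refine ⟨(hmem 0 (by omega)).toLp, (hmem r (by omega)).toLp, ?_, hV, ?_, fun F hF => ?_,
    fun j => glue t (A (r + j)) (B (r + j)), fun j hj => ?_, hV.trans (hG r), ?_⟩
  · simpa using hU
  · rw [Lp.norm_toLp, huN, ENNReal.toReal_ofReal hN]
  · have h1 := hAB.integral_eq hk (by omega) ht' hF
    rw [intervalIntegral_eq_integral_μI, intervalIntegral_eq_integral_μI] at h1 ⊢
    have hV1 := integral_congr_ae ((hV.trans (hG r)).mul (EventuallyEq.refl _ (F 0)))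
    have hU1 := integral_congr_ae ((hU.trans (hG 0)).mul (EventuallyEq.refl _ (F r)))
    simp only [Pi.mul_apply] at hV1 hU1
    rw [hV1, hU1, h1]
    ring
  · refine isPrim_glue ht' (hAB.left _ (by omega)) (hAB.right _ (by omega)) ?_
    have := hAB.jump (r + j) (by omega)
    rw [if_neg (by omega)] at this
    linarith
  · have hode : iteratedDeriv (2 * r) u =ᵐ[μI] fun x => -(-1) ^ r * lam * u x := by
      have h1 : ((-1 : ℝ) ^ r) * (-1) ^ r = 1 := by rw [← mul_pow]; norm_num
      have h2 : ∀ x ∈ Ioo (-1) t ∪ Ioo t 1,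
          iteratedDeriv (2 * r) u x = -(-1) ^ r * lam * u x := fun x hx => by
        linear_combination (-1) ^ r * h.ode x hx - iteratedDeriv (2 * r) u x * h1
      refine ae_of_halves (t := t) ?_ ?_
      · exact (ae_restrict_iff' measurableSet_Ioo).2
          (Eventually.of_forall fun x hx => h2 x (Or.inl hx))
      · exact (ae_restrict_iff' measurableSet_Ioo).2
          (Eventually.of_forall fun x hx => h2 x (Or.inr hx))
    simp only [← two_mul]
    filter_upwards [(hG (2 * r)).symm, hode, hU] with x h1 h2 h3
    rw [h1, h2, h3, iteratedDeriv_zero]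

theorem IsChain.le_deviation {r k : ℕ} {t : ℝ} (hk : k < r) (ht : t ∈ Ioo (-1 : ℝ) 1)
    {F : ℕ → ℝ → ℝ} (hF : IsChain r (-1) 1 F) (hFr : MemLp (F r) 2 μI)
    (hF1 : eLpNorm (F r) 2 μI ≤ 1) {g : L2} (hg : g =ᵐ[μI] F 0) (S : L2 → ℝ) :
    ENNReal.ofReal |F k t - S g| ≤ deviation r k t S := by
  have hs := hF.mem_sobolevL2 (by norm_num) (eqOn_refl (F 0) _) (by omega) hFr
  have hae := hF.iteratedDerivWithin_ae (by norm_num) (eqOn_refl (F 0) _) (by omega)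
  let f : classW r := ⟨F 0, hs, by rwa [eLpNorm_congr_ae hae]⟩
  have h1 : pointDeriv k t f = F k t :=
    hF.iteratedDerivWithin_eqOn (by norm_num) (eqOn_refl (F 0) _) hk.le
      (hF.continuousOn (by norm_num) hk) (Ioo_subset_Icc_self ht)
  have h2 : toL2 f = g := Lp.ext ((MemLp.coeFn_toLp _).trans hg.symm)
  have h3 := le_iSup (fun f : classW r => ENNReal.ofReal |pointDeriv k t f - S (toL2 f)|) f
  simp only [h1, h2] at h3
  exact h3

theorem eLpNorm_coe_eq (f : L2) : eLpNorm f 2 μI = ENNReal.ofReal ‖f‖ := by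
  rw [Lp.norm_def, ENNReal.ofReal_toReal (Lp.eLpNorm_ne_top f)]

theorem isChain_const_mul {m : ℕ} {a b : ℝ} {F : ℕ → ℝ → ℝ} (hF : IsChain m a b F) (hab : a ≤ b)
    (c : ℝ) : IsChain m a b (fun j x => c * F j x) := fun j hj => (hF j hj).const_mul c hab

theorem eLpNorm_const_mul_le_one {f : ℝ → ℝ} {g : L2} (h : f =ᵐ[μI] g) {c : ℝ}
    (hc : |c| * ‖g‖ ≤ 1) : eLpNorm (fun x => c * f x) 2 μI ≤ 1 := by
  have : (fun x => c * f x) =ᵐ[μI] (c • g : L2) := by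
    filter_upwards [h, Lp.coeFn_smul c g] with x h1 h2
    rw [h1, h2]; rfl
  rw [eLpNorm_congr_ae this, eLpNorm_coe_eq, norm_smul, Real.norm_eq_abs]
  exact ENNReal.ofReal_le_one.2 hc

/-- The error is `-(-1)^r ⟨U, F^(r)⟩`. Cauchy-Schwarz bounds it by `‖U‖`, with equality for the
`r`-fold primitive of `U / ‖U‖`. -/
theorem deviation_innerSL {r k : ℕ} {t : ℝ} (hk : k < r) (ht : t ∈ Ioo (-1 : ℝ) 1) {U V : L2}
    (h : ∀ F : ℕ → ℝ → ℝ, IsChain r (-1) 1 F → F k t =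
        (∫ x in (-1 : ℝ)..1, V x * F 0 x) - (-1) ^ r * ∫ x in (-1 : ℝ)..1, U x * F r x) :
    deviation r k t (innerSL ℝ V) = ENNReal.ofReal ‖U‖ := by
  have habs : |(-1 : ℝ) ^ r| = 1 := by simp
  refine le_antisymm (iSup_le fun f => ENNReal.ofReal_le_ofReal ?_) ?_
  · have hc := SobolevL2.isChain f.2.1 (by omega) (by norm_num)
    have h1 := h _ hc
    have hL : MemLp (iteratedDerivWithin r (f : ℝ → ℝ) (Icc (-1) 1)) 2 μI := f.2.1.2.2
    have e1 : toL2 f =ᵐ[μI] iteratedDerivWithin 0 (f : ℝ → ℝ) (Icc (-1) 1) := by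
      rw [iteratedDerivWithin_zero]
      exact MemLp.coeFn_toLp _
    rw [← inner_eq_intervalIntegral (f := V) EventuallyEq.rfl e1,
      ← inner_eq_intervalIntegral (f := U) EventuallyEq.rfl hL.coeFn_toLp] at h1
    have hn : ‖hL.toLp‖ ≤ 1 := by
      rw [Lp.norm_toLp]
      exact ENNReal.toReal_le_of_le_ofReal zero_le_one (by simpa using f.2.2)
    rw [pointDeriv, h1, innerSL_apply_apply, sub_sub_cancel_left, abs_neg, abs_mul, habs, one_mul]
    refine (abs_real_inner_le_norm _ _).trans ?_
    exact mul_le_of_le_one_right (norm_nonneg _) hn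
  · rcases (norm_nonneg U).eq_or_lt with h0 | h0
    · rw [← h0]; simp
    have hc := isChain_const_mul (IsChain.of_prim (a := -1) (b := 1) (c := -1) (by norm_num)
      (intervalIntegrable_of_memLp (Lp.memLp U)) r) (by norm_num) ‖U‖⁻¹
    have hL0 := memLp_of_continuousOn (hc.continuousOn (j := 0) (by norm_num) (by omega))
    have h1 := h _ hc
    have h2 := hc.le_deviation hk ht (by simpa using (Lp.memLp U).const_mul ‖U‖⁻¹)
      (by
        simp only [Nat.sub_self, Function.iterate_zero, id_eq]
        refine eLpNorm_const_mul_le_one EventuallyEq.rfl ?_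
        rw [abs_inv, abs_norm, inv_mul_cancel₀ h0.ne'])
      hL0.coeFn_toLp (innerSL ℝ V)
    rw [innerSL_apply_apply, inner_eq_intervalIntegral EventuallyEq.rfl hL0.coeFn_toLp, h1,
      sub_sub_cancel_left, abs_neg, abs_mul, habs, one_mul] at h2
    refine le_trans (le_of_eq ?_) h2
    congr 1
    simp only [Nat.sub_self, Function.iterate_zero, id_eq]
    have h3 : ∀ x, U x * (‖U‖⁻¹ * U x) = ‖U‖⁻¹ * (U x * U x) := fun x => by ring
    simp_rw [h3]
    rw [intervalIntegral.integral_const_mul,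
      ← inner_eq_intervalIntegral (f := U) (g := U) EventuallyEq.rfl EventuallyEq.rfl,
      real_inner_self_eq_norm_sq, sq, inv_mul_cancel_left₀ h0.ne', abs_norm]

/-- The extremal function is a multiple of `V`, for which the identity gives the derivative `N^2 +
lam ‖U‖^2` at `t`, whereas `S V ≤ N^2`. -/
theorem le_deviation_of_norm_le {r k : ℕ} {t lam N : ℝ} (hk : k < r) (ht : t ∈ Ioo (-1 : ℝ) 1)
    (hlam : 0 ≤ lam) {U V : L2} (hV : ‖V‖ = N)
    (h : ∀ F : ℕ → ℝ → ℝ, IsChain r (-1) 1 F → F k t =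
        (∫ x in (-1 : ℝ)..1, V x * F 0 x) - (-1) ^ r * ∫ x in (-1 : ℝ)..1, U x * F r x)
    {F : ℕ → ℝ → ℝ} (hF : IsChain r (-1) 1 F) (hF0 : V =ᵐ[μI] F 0)
    (hFr : F r =ᵐ[μI] fun x => -(-1) ^ r * lam * U x) (S : L2 →L[ℝ] ℝ) (hS : ‖S‖ ≤ N) :
    ENNReal.ofReal ‖U‖ ≤ deviation r k t S := by
  have hsq : ((-1 : ℝ) ^ r) * (-1) ^ r = 1 := by rw [← mul_pow]; norm_num
  have hFr' : F r =ᵐ[μI] ((-(-1) ^ r * lam) • U : L2) := by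
    filter_upwards [hFr, Lp.coeFn_smul (-(-1) ^ r * lam) U] with x h1 h2
    rw [h1, h2]; rfl
  have hval : F k t = N ^ 2 + lam * ‖U‖ ^ 2 := by
    rw [h F hF, ← inner_eq_intervalIntegral (f := V) EventuallyEq.rfl hF0,
      ← inner_eq_intervalIntegral (f := U) EventuallyEq.rfl hFr'.symm, inner_smul_right,
      real_inner_self_eq_norm_sq, real_inner_self_eq_norm_sq, hV]
    linear_combination lam * ‖U‖ ^ 2 * hsq
  have hbound : ∀ c : ℝ, |c| * (lam * ‖U‖) ≤ 1 →
      ENNReal.ofReal |c * (N ^ 2 + lam * ‖U‖ ^ 2 - S V)| ≤ deviation r k t S := by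
    intro c hc
    have hg : (c • V : L2) =ᵐ[μI] fun x => c * F 0 x := by
      filter_upwards [hF0, Lp.coeFn_smul c V] with x h1 h2
      rw [h2, Pi.smul_apply, h1]; rfl
    have h1 := (isChain_const_mul hF (by norm_num) c).le_deviation hk ht
      (((Lp.memLp _).ae_eq hFr'.symm).const_mul c)
      (eLpNorm_const_mul_le_one hFr' (by
        rw [norm_smul, Real.norm_eq_abs, abs_mul, abs_neg, abs_pow, abs_neg, abs_one, one_pow,
          one_mul, abs_of_nonneg hlam]
        exact hc)) hg S
    rw [map_smul, smul_eq_mul, hval, ← mul_sub] at h1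
    exact h1
  have hSV : S V ≤ N ^ 2 := by
    refine (le_abs_self _).trans ((S.le_opNorm V).trans ?_)
    rw [hV, sq]
    exact mul_le_mul_of_nonneg_right hS (hV ▸ norm_nonneg V)
  rcases (norm_nonneg U).eq_or_lt with h0 | h0
  · rw [← h0]; simp
  -- For `lam = 0` the `r`-th derivative of `V` vanishes, so every multiple of `V` is admissible and
  -- a suitable one suffices unless `S V = N^2`. In that case equality in Cauchy-Schwarz forces `S =
  -- ⟨V, ·⟩`, whose deviation is known.
  rcases hlam.eq_or_lt with rfl | hlam
  · by_cases hSV' : S V = N ^ 2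
    · have hSeq : S = innerSL ℝ V := by
        set s := (InnerProductSpace.toDual ℝ L2).symm S with hs
        have hsS : ∀ x, inner ℝ s x = S x := fun x => InnerProductSpace.toDual_symm_apply
        have hsn : ‖s‖ ≤ N := by rw [hs, LinearIsometryEquiv.norm_map]; exact hS
        have h1 : ‖s - V‖ ^ 2 ≤ 0 := by
          rw [norm_sub_sq_real, hsS, hSV', hV]
          have := pow_le_pow_left₀ (norm_nonneg s) hsn 2
          linarith
        have h2 : s = V := by
          have := le_antisymm h1 (sq_nonneg _)
          exact sub_eq_zero.1 (by simpa using this)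
        ext x
        rw [← hsS, h2, innerSL_apply_apply]
      rw [hSeq, deviation_innerSL hk ht h]
    · have hd : N ^ 2 - S V ≠ 0 := sub_ne_zero.2 (Ne.symm hSV')
      have := hbound (‖U‖ / (N ^ 2 - S V)) (by simp)
      rwa [zero_mul, add_zero, div_mul_cancel₀ _ hd, abs_norm] at this
  -- For `lam > 0` the factor `(lam ‖U‖)⁻¹` makes the `r`-th derivative of `V` have norm one.
  · refine le_trans (ENNReal.ofReal_le_ofReal ?_) (hbound (lam * ‖U‖)⁻¹ (by
      rw [abs_of_nonneg (by positivity), inv_mul_cancel₀ (by positivity)]))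
    refine le_trans ?_ (le_abs_self _)
    rw [← div_eq_inv_mul, le_div_iff₀ (by positivity)]
    nlinarith

/-- Since `N` is not admissible in the polynomial inequality, some `p` has `|p^(k)(t)| > N ‖p‖ ≥ |S
p|`. Multiples of `p` have zero `r`-th derivative, so they stay in the class while the error grows
without bound. -/
theorem bestError_eq_top {r k : ℕ} {t N : ℝ} (hk : k < r) (ht : t ∈ Ioo (-1 : ℝ) 1) (hN : 0 ≤ N)
    (h : N < markovConst r k t) : bestError r k t N = ∞ := by
  have hnot := notMem_of_lt_csInf h ⟨0, fun _ h => h.1⟩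
  simp only [mem_ofPred_eq, hN, true_and, not_forall, not_le] at hnot
  obtain ⟨p, hp, hpN⟩ := hnot
  rw [← norm_polyL2] at hpN
  refine iInf_eq_top.2 fun S => iInf_eq_top.2 fun hS => ?_
  set d := (Polynomial.derivative^[k] p).eval t - S (polyL2 p) with hd
  have hd0 : 0 < |d| := by
    have h1 : |S (polyL2 p)| ≤ N * ‖polyL2 p‖ :=
      (S.le_opNorm _).trans (mul_le_mul_of_nonneg_right hS (norm_nonneg _))
    have h2 := abs_sub_abs_le_abs_sub ((Polynomial.derivative^[k] p).eval t) (S (polyL2 p))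
    linarith
  have hc := isChain_polynomial p r (a := -1) (b := 1) (by norm_num)
  refine ENNReal.eq_top_of_forall_nnreal_le fun x => ?_
  have hz : (fun y => (x / |d|) * (Polynomial.derivative^[r] p).eval y) = fun _ => (0 : ℝ) := by
    simp [iterate_derivative_eq_zero_of_mem_degreeLT hp]
  have h3 := (isChain_const_mul hc (by norm_num) (x / |d|)).le_deviation hk ht
    (g := (x / |d|) • polyL2 p) (by rw [hz]; simp) (by rw [hz]; simp) (by
      filter_upwards [Lp.coeFn_smul ((x : ℝ) / |d|) (polyL2 p), coeFn_polyL2 p] with y h1 h2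
      rw [h1, Pi.smul_apply, h2]; rfl) S
  rw [map_smul, smul_eq_mul, ← mul_sub, ← hd, abs_mul, abs_div, abs_abs, div_mul_cancel₀ _ hd0.ne',
    abs_of_nonneg x.coe_nonneg, ENNReal.ofReal_coe_nnreal] at h3
  exact h3

end Stechkin

theorem mainTheorem6 (r k : ℕ) (hr : 1 ≤ r) (hk : k ≤ r - 1) (t : ℝ) (ht : t ∈ Ioo (-1 : ℝ) 1) :
    (∀ N : ℝ, 0 ≤ N → N < Stechkin.markovConst r k t → Stechkin.bestError r k t N = ∞) ∧
    (∀ N : ℝ, Stechkin.markovConst r k t ≤ N →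
      (∃ lam : ℝ, 0 ≤ lam ∧ ∃ u : ℝ → ℝ, Stechkin.IsSolution r k t lam u ∧
        eLpNorm (iteratedDeriv r u) 2 Stechkin.μI = ENNReal.ofReal N) ∧
      (∀ lam : ℝ, 0 ≤ lam → ∀ u : ℝ → ℝ, Stechkin.IsSolution r k t lam u →
        eLpNorm (iteratedDeriv r u) 2 Stechkin.μI = ENNReal.ofReal N →
        Stechkin.bestError r k t N = eLpNorm u 2 Stechkin.μI ∧
        ∃ S : Stechkin.L2 →L[ℝ] ℝ,
          (∀ g : Stechkin.L2, S g = ∫ x in (-1 : ℝ)..1, iteratedDeriv r u x * g x) ∧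
          ‖S‖ ≤ N ∧
          Stechkin.deviation r k t S = eLpNorm u 2 Stechkin.μI)) := by
  have hk' : k < r := by omega
  refine ⟨fun N hN h => Stechkin.bestError_eq_top hk' ht hN h, fun N hN =>
    ⟨Stechkin.exists_isSolution hk' ht hN, fun lam hlam u hu huN => ?_⟩⟩
  have hN0 : 0 ≤ N := (Stechkin.markovConst_nonneg r k t).trans hN
  obtain ⟨U, V, hU, hV, hVN, hid, F, hF, hF0, hFr⟩ := hu.exists_L2 hk' ht hN0 huN
  have hdev := Stechkin.deviation_innerSL hk' ht hid
  have hSN : ‖innerSL ℝ V‖ ≤ N := by rw [innerSL_apply_norm, hVN]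
  rw [← eLpNorm_congr_ae hU, Stechkin.eLpNorm_coe_eq]
  refine ⟨le_antisymm ?_ (le_iInf₂ fun S hS =>
    Stechkin.le_deviation_of_norm_le hk' ht hlam hVN hid hF hF0 hFr S hS), innerSL ℝ V,
    fun g => ?_, hSN, hdev⟩
  · exact (iInf₂_le (innerSL ℝ V) hSN).trans hdev.le
  · rw [innerSL_apply_apply]
    exact Stechkin.inner_eq_intervalIntegral hV EventuallyEq.rfl
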